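/- Setting. Fix a signature consisting of constants (among them a distinct constant for each integer), predicate symbols with arities, and aggregate function symbols $aggr$, each with a fixed interpretation mapping finite sets and finite multisets of constants to $\mathbb Z$; symbols are written as binary words, injectively for each kind of symbol. A ground program $P$ is a finite collection of rules $A \leftarrow C_1,\dots,C_m,A_1,\dots,A_n,\mathit{not}\,B_1,\dots,\mathit{not}\,B_k$ over a finite set of constants and a finite set of predicate symbols, with Herbrand base $\mathcal B_P$; here $A,A_i,B_j$ are ground atoms and the $C_i$ are ground aggregate atoms $aggr(s)\ \mathtt{op}\ v$ with $\mathtt{op}\in\{=,\neq,<,>,\leq,\geq\}$, $v\in\mathbb Z$, and $s$ an intensional set $\{X\mid p(\dots)\}$ or an intensional multiset $\{\!\{X\mid \exists \bar Z.\,p(\dots)\}\!\}$. An interpretation is a subset of $\mathcal B_P$, and $I\models aggr(s)\ \mathtt{op}\ v$ means that the value of $aggr$ on the (multi)set of values of $X$ collected in $I$ stands in relation $\mathtt{op}$ to $v$. For an aggregate atom $\ell$ let $\mathcal H(\ell)\subseteq\mathcal B_P$ be the set of atoms with the predicate $p$ of $\ell$. A pair $\langle S_1,S_2\rangle$ of disjoint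 subsets of $\mathcal H(\ell)$ is a solution of $\ell$ if $I\models\ell$ for every interpretation $I$ with $S_1\subseteq I$ and $S_2\cap I=\emptyset$. For interpretations $I,M$ put $$K^P_M(I)=\{\,head(r)\mid r\in P,\ neg(r)\cap M=\emptyset,\ pos(r)\subseteq I,\ \langle I\cap M\cap\mathcal H(\ell),\ \mathcal H(\ell)\setminus M\rangle\text{ is a solution of }\ell\text{ for every }\ell\in agg(r)\,\}.$$ $M$ is a fixpoint answer set of $P$ if $M$ is the least fixpoint of $K^P_M$ in $2^{\mathcal B_P}$. Let $C$ be a class of languages over $\{0,1\}$. $\mathbf{NP}^C$ is the union over $A\in C$ of the classes $\mathbf{NP}^A$ of languages that have certificates of polynomial length which are verifiable in deterministic polynomial time with oracle $A$; $\mathbf{co\text{-}NP}^C$ is the class of the complements of the languages in $\mathbf{NP}^C$. A set $\mathcal A$ of ground aggregate atoms is $C$-decidable if there is a language in $C$ that decides, for every given $\ell\in\mathcal A$ and every given interpretation $M$ (a finite set of atoms, listed without repetition), whether $M\models\ell$. Theorem. Let $\mathcal A$ be a $C$-decidable set of ground aggregate atoms. Then the answer set checking problem for programs with aggregate atoms in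 $\mathcal A$ (given a ground program $P$ all of whose aggregate atoms belong to $\mathcal A$ and an interpretation $M$ of $P$, determine whether $M$ is a fixpoint answer set of $P$) is in $\mathbf{co\text{-}NP}^C$: there is a language in $\mathbf{co\text{-}NP}^C$ that contains the encoding of such an instance $(P,M)$ if and only if $M$ is a fixpoint answer set of $P$. -/

import Mathlib

/-! ## Words, oracle machines, and the classes `P^A`, `NP^A`, `coNP^C` -/

/-- Self-delimiting binary encoding of a finite sequence of words: every bit `b` of an item is
written `1b`, and the end of an item is written `0`. -/
def encWords (l : List (List Bool)) : List Bool :=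
  l.flatMap fun w => (w.flatMap fun b => [true, b]) ++ [false]

/-- The elementary operations of an oracle machine with stacks (half-tapes) indexed by `K` and
control states `Λ`. -/
inductive OracleInstr (K Λ : Type) : Type
  /-- push a bit on a stack and go to a state -/
  | push (k : K) (b : Bool) (next : Λ)
  /-- remove the top bit of a stack and branch on it (`none`: the stack was empty) -/
  | pop (k : K) (next : Option Bool → Λ)
  /-- ask the oracle whether the word on a stack, read from the top, belongs to it, and branch -/
  | query (k : K) (next : Bool → Λ)
  /-- stop with a verdict -/
  | halt (verdict : Bool)

/-- A deterministic oracle Turing machine, in its multi-stack form (a tape is a pair of stacks):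
finitely many stacks over the binary alphabet, finitely many control states, one elementary
operation for each state. -/
structure OracleMachine where
  K : Type
  [decEqK : DecidableEq K]
  [fintypeK : Fintype K]
  Λ : Type
  [fintypeΛ : Fintype Λ]
  input : K
  start : Λ
  instr : Λ → OracleInstr K Λ

attribute [instance] OracleMachine.decEqK OracleMachine.fintypeK OracleMachine.fintypeΛ

namespace OracleMachine

structure Cfg (T : OracleMachine) where
  state : T.Λ
  stk : T.K → List Bool

open Classical in
/-- One computation step with oracle `A`; a halted configuration does not change. -/
noncomputable def step (T : OracleMachine) (A : Language Bool) (c : T.Cfg) : T.Cfg :=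
  match T.instr c.state with
  | .push k b next => ⟨next, Function.update c.stk k (b :: c.stk k)⟩
  | .pop k next => ⟨next (c.stk k).head?, Function.update c.stk k (c.stk k).tail⟩
  | .query k next => ⟨next (decide (c.stk k ∈ A)), c.stk⟩
  | .halt _ => c

/-- The verdict of a configuration, if it is a halted one. -/
def verdict (T : OracleMachine) (c : T.Cfg) : Option Bool :=
  match T.instr c.state with
  | .halt b => some b
  | _ => none

/-- The initial configuration: the input word on the input stack, all other stacks empty. -/
def init (T : OracleMachine) (w : List Bool) : T.Cfg :=
  ⟨T.start, Function.update (fun _ => []) T.input w⟩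

/-- With oracle `A`, started on `w`, the machine halts with verdict `b` within `t` steps. -/
def HaltsIn (T : OracleMachine) (A : Language Bool) (w : List Bool) (t : ℕ) (b : Bool) : Prop :=
  T.verdict ((T.step A)^[t] (T.init w)) = some b

end OracleMachine

/-- `P^A`: languages decided by a deterministic oracle machine with oracle `A` in polynomially
many steps. -/
def PRel (A : Language Bool) : Set (Language Bool) :=
  {L | ∃ (T : OracleMachine) (p : Polynomial ℕ), ∀ w : List Bool,
    ∃ b : Bool, T.HaltsIn A w (p.eval w.length) b ∧ (b = true ↔ w ∈ L)}

/-- `NP^A`: languages with certificates of polynomial length that are verifiable in `P^A`. -/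
def NPRel (A : Language Bool) : Set (Language Bool) :=
  {L | ∃ V ∈ PRel A, ∃ q : Polynomial ℕ, ∀ w : List Bool,
    w ∈ L ↔ ∃ y : List Bool, y.length ≤ q.eval w.length ∧ encWords [w, y] ∈ V}

/-- `NP^C`, the union of `NP^A` over the oracles `A` in `C`. -/
def NPClass (C : Set (Language Bool)) : Set (Language Bool) :=
  {L | ∃ A ∈ C, L ∈ NPRel A}

/-- `co-NP^C`: the complements of the languages in `NP^C`. -/
def CoNPClass (C : Set (Language Bool)) : Set (Language Bool) :=
  {L | ∃ N ∈ NPClass C, ∀ w : List Bool, w ∈ L ↔ w ∉ N}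

/-! ## Ground logic programs with aggregates -/

/-- A signature: constants (with distinct constants for the integers), predicate symbols with
arities, and aggregate function symbols with their fixed interpretation, which maps a finite set
or a finite multiset of constants to an integer. The symbols are written down as binary words,
distinct symbols of the same kind as distinct words. -/
structure AspSignature where
  Const : Type
  int : ℤ → Const
  int_injective : Function.Injective int
  Pred : Type
  arity : Pred → ℕ
  Agg : Type
  aggInterp : Agg → Finset Const ⊕ Multiset Const → ℤ
  constName : Const → List Bool
  constName_injective : Function.Injective constName
  predName : Pred → List Bool
  predName_injective : Function.Injective predName
  aggName : Agg → List Bool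
  aggName_injective : Function.Injective aggName

namespace AspSignature

variable (S : AspSignature)

/-- Ground ASP-atoms `p(c₁,…,cₙ)`. -/
structure Atom where
  pred : S.Pred
  args : Fin (S.arity pred) → S.Const

/-- A pattern `p(Y₁,…,Yₘ)` each of whose arguments is a constant or one of the bound variables
with numbers `0, …, r`, each of which occurs. Number `0` is the grouped variable `X`, the numbers
`1, …, r` are the local variables `Z₁, …, Zᵣ`. -/
structure Pattern (r : ℕ) where
  pred : S.Pred
  args : Fin (S.arity pred) → S.Const ⊕ Fin (r + 1)
  occurs : ∀ j : Fin (r + 1), ∃ i, args i = Sum.inr j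

/-- Ground intensional sets `{X | p(…)}` and multisets `{{X | ∃ Z₁ … Zᵣ. p(…)}}`. -/
inductive IntensionalSet
  | set (p : S.Pattern 0)
  | multiset (r : ℕ) (p : S.Pattern r)

end AspSignature

/-- The relational operators of aggregate atoms. -/
inductive RelOp
  | eq | ne | lt | gt | le | ge

def RelOp.Holds : RelOp → ℤ → ℤ → Prop
  | .eq, a, b => a = b
  | .ne, a, b => a ≠ b
  | .lt, a, b => a < b
  | .gt, a, b => a > b
  | .le, a, b => a ≤ b
  | .ge, a, b => a ≥ b

def RelOp.name : RelOp → List Bool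
  | .eq => [false, false, false]
  | .ne => [false, false, true]
  | .lt => [false, true, false]
  | .gt => [false, true, true]
  | .le => [true, false, false]
  | .ge => [true, false, true]

namespace AspSignature

variable (S : AspSignature)

/-- Ground aggregate atoms `aggr(s) op result`. -/
structure AggAtom where
  aggr : S.Agg
  source : S.IntensionalSet
  op : RelOp
  result : ℤ

/-- Ground rules `head ← agg, pos, not neg`. -/
structure Rule where
  head : S.Atom
  agg : List S.AggAtom
  pos : List S.Atom
  neg : List S.Atom

/-- A (finite) program signature: the constants `F_P`, which form the Herbrand universe, and the
predicate symbols `Π_P`. -/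
structure ProgSig where
  consts : Finset S.Const
  preds : Finset S.Pred

variable {S}

/-- The Herbrand base `B_P`. An interpretation is a subset of it. -/
def ProgSig.base (σ : S.ProgSig) : Set S.Atom :=
  {a | a.pred ∈ σ.preds ∧ ∀ i, a.args i ∈ σ.consts}

/-- The ground instance of a pattern under a substitution of constants for its variables. -/
def Pattern.inst {r : ℕ} (p : S.Pattern r) (γ : Fin (r + 1) → S.Const) : S.Atom :=
  ⟨p.pred, fun i => Sum.elim id γ (p.args i)⟩

def Pattern.Over {r : ℕ} (p : S.Pattern r) (σ : S.ProgSig) : Prop :=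
  p.pred ∈ σ.preds ∧ ∀ i c, p.args i = Sum.inl c → c ∈ σ.consts

/-- The grouped predicate. -/
def IntensionalSet.pred : S.IntensionalSet → S.Pred
  | .set p => p.pred
  | .multiset _ p => p.pred

def IntensionalSet.Over (s : S.IntensionalSet) (σ : S.ProgSig) : Prop :=
  match s with
  | .set p => p.Over σ
  | .multiset _ p => p.Over σ

open Classical in
/-- The value of an intensional (multi)set in the interpretation `I`: the set of the constants
`a` with `p(…)[X/a]` true, respectively the multiset in which `a` is repeated once for each
substitution of the variables that maps `X` to `a` and makes `p(…)` true. -/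
noncomputable def IntensionalSet.value (σ : S.ProgSig) (I : Set S.Atom) :
    S.IntensionalSet → Finset S.Const ⊕ Multiset S.Const
  | .set p => Sum.inl (σ.consts.filter fun a => p.inst (fun _ => a) ∈ I)
  | .multiset r p => Sum.inr
      (((Fintype.piFinset fun _ : Fin (r + 1) => σ.consts).filter
        fun γ => p.inst γ ∈ I).val.map fun γ => γ 0)

/-- The aggregate atom belongs to the language of the program signature. -/
def AggAtom.Over (ℓ : S.AggAtom) (σ : S.ProgSig) : Prop :=
  ℓ.source.Over σ ∧ S.int ℓ.result ∈ σ.consts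

/-- `I ⊨ ℓ`. -/
def AggAtom.Sat (σ : S.ProgSig) (I : Set S.Atom) (ℓ : S.AggAtom) : Prop :=
  ℓ.op.Holds (S.aggInterp ℓ.aggr (ℓ.source.value σ I)) ℓ.result

/-- `H(ℓ)`: the atoms of the Herbrand base with the grouped predicate of `ℓ`. -/
def AggAtom.ext (σ : S.ProgSig) (ℓ : S.AggAtom) : Set S.Atom :=
  {a ∈ σ.base | a.pred = ℓ.source.pred}

/-- `⟨S₁, S₂⟩` is an aggregate solution of `ℓ`. -/
def AggAtom.IsSolution (σ : S.ProgSig) (ℓ : S.AggAtom) (S₁ S₂ : Set S.Atom) : Prop :=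
  S₁ ⊆ ℓ.ext σ ∧ S₂ ⊆ ℓ.ext σ ∧ Disjoint S₁ S₂ ∧
    ∀ I ⊆ σ.base, S₁ ⊆ I → S₂ ∩ I = ∅ → ℓ.Sat σ I

/-- Conditional satisfaction `(I, M) ⊨ ℓ` of an aggregate atom. -/
def AggAtom.CondSat (σ : S.ProgSig) (I M : Set S.Atom) (ℓ : S.AggAtom) : Prop :=
  ℓ.IsSolution σ (I ∩ M ∩ ℓ.ext σ) (ℓ.ext σ \ M)

def Rule.Over (r : S.Rule) (σ : S.ProgSig) : Prop :=
  r.head ∈ σ.base ∧ (∀ a ∈ r.pos, a ∈ σ.base) ∧ (∀ a ∈ r.neg, a ∈ σ.base) ∧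
    ∀ ℓ ∈ r.agg, ℓ.Over σ

variable (S)

/-- A ground program: a finite collection of ground rules over a finite program signature. -/
structure Program where
  sig : S.ProgSig
  rules : List S.Rule
  rules_over : ∀ r ∈ rules, r.Over sig

variable {S}

namespace Program

/-- The reduct of `P` with respect to `M`. -/
def reduct (P : S.Program) (M : Set S.Atom) : Set S.Rule :=
  {r' | ∃ r ∈ P.rules, (∀ b ∈ r.neg, b ∉ M) ∧ r' = ⟨r.head, r.agg, r.pos, []⟩}

/-- The consequence operator `K_M^P`. -/
def K (P : S.Program) (M I : Set S.Atom) : Set S.Atom :=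
  {a | ∃ r ∈ P.reduct M, (∀ b ∈ r.pos, b ∈ I) ∧ (∀ ℓ ∈ r.agg, ℓ.CondSat P.sig I M) ∧
    a = r.head}

/-- `M` is a fixpoint answer set of `P`: it is the least fixpoint of `K_M^P` among the
interpretations of `P`. -/
def IsFixpointAnswerSet (P : S.Program) (M : Set S.Atom) : Prop :=
  IsLeast {I : Set S.Atom | I ⊆ P.sig.base ∧ P.K M I = I} M

end Program

/-! ## Encodings and the decision problems -/

def Atom.enc (a : S.Atom) : List Bool :=
  encWords (S.predName a.pred :: List.ofFn fun i => S.constName (a.args i))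

/-- A finite set of atoms is written down by listing its elements. -/
def encAtoms (l : List S.Atom) : List Bool :=
  encWords (l.map Atom.enc)

def Pattern.enc {r : ℕ} (p : S.Pattern r) : List Bool :=
  encWords (S.predName p.pred :: List.ofFn fun i =>
    Sum.elim (fun c => true :: S.constName c) (fun j => false :: Nat.bits j) (p.args i))

def IntensionalSet.enc : S.IntensionalSet → List Bool
  | .set p => false :: p.enc
  | .multiset _ p => true :: p.enc

def AggAtom.enc (ℓ : S.AggAtom) : List Bool :=
  encWords [S.aggName ℓ.aggr, ℓ.source.enc, ℓ.op.name, S.constName (S.int ℓ.result)]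

def Rule.enc (r : S.Rule) : List Bool :=
  encWords [r.head.enc, encWords (r.agg.map AggAtom.enc), encAtoms r.pos, encAtoms r.neg]

/-- An instance of the answer set checking problem: the rules of `P` and the atoms of `M`. -/
def Program.encWith (P : S.Program) (M : List S.Atom) : List Bool :=
  encWords [encWords (P.rules.map Rule.enc), encAtoms M]

/-- The interpretation `M` of the program signature `σ` is given by the list `l`, which enumerates
its elements without repetition. -/
def Lists (σ : S.ProgSig) (l : List S.Atom) (M : Set S.Atom) : Prop :=
  M ⊆ σ.base ∧ l.Nodup ∧ ∀ a, a ∈ l ↔ a ∈ M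

/-- The aggregate atoms in `𝒜` are `C`-decidable: some oracle in `C` tells, for an aggregate atom
of `𝒜` and an interpretation, whether the atom is true in the interpretation. -/
def CDecidable (C : Set (Language Bool)) (𝒜 : Set S.AggAtom) : Prop :=
  ∃ A ∈ C, ∀ (σ : S.ProgSig) (ℓ : S.AggAtom), ℓ ∈ 𝒜 → ℓ.Over σ →
    ∀ (l : List S.Atom) (M : Set S.Atom), Lists σ l M →
      (encWords [ℓ.enc, encAtoms l] ∈ A ↔ ℓ.Sat σ M)

/-- All aggregate atoms that occur in `P` belong to `𝒜`. -/
def Program.AggregatesIn (P : S.Program) (𝒜 : Set S.AggAtom) : Prop :=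
  ∀ r ∈ P.rules, ∀ ℓ ∈ r.agg, ℓ ∈ 𝒜

/-- The language `L` solves the answer set checking problem for the programs with aggregate atoms
in `𝒜`: on each instance (a program with aggregate atoms in `𝒜` and an interpretation of it),
membership in `L` tells whether the interpretation is a fixpoint answer set. -/
def SolvesACP (𝒜 : Set S.AggAtom) (L : Language Bool) : Prop :=
  ∀ (P : S.Program), P.AggregatesIn 𝒜 → ∀ (l : List S.Atom) (M : Set S.Atom),
    Lists P.sig l M → (P.encWith l ∈ L ↔ P.IsFixpointAnswerSet M)

end AspSignature

/-! ## Structured stack programs -/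

/-- Structured programs over stacks indexed by `K`. -/
inductive StackProg (K : Type) : Type
  | skip
  | push (k : K) (b : Bool)
  | pop (k : K) (f : Option Bool → StackProg K)
  | query (k : K) (f : Bool → StackProg K)
  | seq (p q : StackProg K)
  /-- Repeatedly pop the stack `k`; leave the loop when it was empty or when the popped bit `b`
  satisfies `brk b`, otherwise execute `f b`. -/
  | loop (k : K) (brk : Bool → Bool) (f : Bool → StackProg K)

namespace StackProg

variable {K : Type}

infixr:60 " ;; " => StackProg.seq

section Semantics

variable [DecidableEq K]

open Classical in
/-- Big-step semantics with oracle `A`, counting elementary machine operations. -/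
inductive Run (A : Language Bool) :
    StackProg K → (K → List Bool) → ℕ → (K → List Bool) → Prop
  | skip (s) : Run A skip s 0 s
  | push (k b s) : Run A (push k b) s 1 (Function.update s k (b :: s k))
  | pop {k f s t s'} (h : Run A (f (s k).head?) (Function.update s k (s k).tail) t s') :
      Run A (pop k f) s (1 + t) s'
  | query {k f s t s'} (h : Run A (f (decide (s k ∈ A))) s t s') :
      Run A (query k f) s (1 + t) s'
  | seq {p q s t s' t' s''} (h : Run A p s t s') (h' : Run A q s' t' s'') :
      Run A (p ;; q) s (t + t') s''
  | loop_nil {k brk f s} (h : s k = []) : Run A (loop k brk f) s 1 s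
  | loop_brk {k brk f s b w} (h : s k = b :: w) (hb : brk b = true) :
      Run A (loop k brk f) s 1 (Function.update s k w)
  | loop_cons {k brk f s b w t s' t' s''} (h : s k = b :: w) (hb : brk b = false)
      (h₁ : Run A (f b) (Function.update s k w) t s') (h₂ : Run A (loop k brk f) s' t' s'') :
      Run A (loop k brk f) s (1 + t + t') s''

end Semantics

/-! ### Compilation to oracle machines -/

/-- The control states needed for a program. -/
def Label : StackProg K → Type
  | skip => Empty
  | push _ _ => Unit
  | pop _ f => Unit ⊕ (Σ o, Label (f o))
  | query _ f => Unit ⊕ (Σ b, Label (f b))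
  | seq p q => Label p ⊕ Label q
  | loop _ _ f => Unit ⊕ (Σ b, Label (f b))

@[reducible]
noncomputable def fintypeLabel : (p : StackProg K) → Fintype (Label p)
  | skip => inferInstanceAs (Fintype Empty)
  | push _ _ => inferInstanceAs (Fintype Unit)
  | pop _ f =>
    haveI := fun o => fintypeLabel (f o)
    inferInstanceAs (Fintype (Unit ⊕ (Σ o, Label (f o))))
  | query _ f =>
    haveI := fun o => fintypeLabel (f o)
    inferInstanceAs (Fintype (Unit ⊕ (Σ o, Label (f o))))
  | seq p q =>
    haveI := fintypeLabel p
    haveI := fintypeLabel q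
    inferInstanceAs (Fintype (Label p ⊕ Label q))
  | loop _ _ f =>
    haveI := fun o => fintypeLabel (f o)
    inferInstanceAs (Fintype (Unit ⊕ (Σ o, Label (f o))))

/-- The state in which a program embedded by `emb` starts, when it is to continue at `nxt`. -/
def entry {Λ : Type} : (p : StackProg K) → (Label p → Λ) → Λ → Λ
  | skip, _, nxt => nxt
  | push _ _, emb, _ => emb ()
  | pop _ _, emb, _ => emb (.inl ())
  | query _ _, emb, _ => emb (.inl ())
  | seq p q, emb, nxt => entry p (fun l => emb (.inl l)) (entry q (fun l => emb (.inr l)) nxt)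
  | loop _ _ _, emb, _ => emb (.inl ())

/-- The machine instructions of a program embedded by `emb` that continues at `nxt`. -/
def code {Λ : Type} : (p : StackProg K) → (Label p → Λ) → Λ → Label p → OracleInstr K Λ
  | skip, _, _ => fun l => nomatch (show Empty from l)
  | push k b, _, nxt => fun _ => .push k b nxt
  | pop k f, emb, nxt => fun l => match l with
    | .inl _ => .pop k fun o => entry (f o) (fun l => emb (.inr ⟨o, l⟩)) nxt
    | .inr ⟨o, l⟩ => code (f o) (fun l => emb (.inr ⟨o, l⟩)) nxt l
  | query k f, emb, nxt => fun l => match l with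
    | .inl _ => .query k fun o => entry (f o) (fun l => emb (.inr ⟨o, l⟩)) nxt
    | .inr ⟨o, l⟩ => code (f o) (fun l => emb (.inr ⟨o, l⟩)) nxt l
  | seq p q, emb, nxt => fun l => match l with
    | .inl l => code p (fun l => emb (.inl l)) (entry q (fun l => emb (.inr l)) nxt) l
    | .inr l => code q (fun l => emb (.inr l)) nxt l
  | loop k brk f, emb, nxt => fun l => match l with
    | .inl _ => .pop k fun o => match o with
      | none => nxt
      | some b => if brk b then nxt else
          entry (f b) (fun l => emb (.inr ⟨b, l⟩)) (emb (.inl ()))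
    | .inr ⟨o, l⟩ => code (f o) (fun l => emb (.inr ⟨o, l⟩)) (emb (.inl ())) l

theorem Run.simulate {T : OracleMachine} {A : Language Bool} {p : StackProg T.K}
    {s : T.K → List Bool} {t : ℕ} {s' : T.K → List Bool} (h : Run A p s t s') :
    ∀ (emb : Label p → T.Λ) (nxt : T.Λ), (∀ l, T.instr (emb l) = code p emb nxt l) →
      (T.step A)^[t] ⟨entry p emb nxt, s⟩ = ⟨nxt, s'⟩ := by
  induction h with
  | skip s => intro emb nxt _; rfl
  | push k b s =>
    intro emb nxt hT
    have := hT ()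
    simp only [code] at this
    simp only [Function.iterate_one, OracleMachine.step, entry, this]
  | @pop k f s t s' h ih =>
    intro emb nxt hT
    rw [add_comm, Function.iterate_add_apply, Function.iterate_one]
    have := hT (.inl ())
    simp only [code] at this
    simp only [OracleMachine.step, entry, this]
    exact ih _ _ fun l => by simpa only [code] using hT (.inr ⟨_, l⟩)
  | @query k f s t s' h ih =>
    intro emb nxt hT
    rw [add_comm, Function.iterate_add_apply, Function.iterate_one]
    have := hT (.inl ())
    simp only [code] at this
    simp only [OracleMachine.step, entry, this]
    exact ih _ _ fun l => by simpa only [code] using hT (.inr ⟨_, l⟩)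
  | @seq p q s t s' t' s'' h h' ih ih' =>
    intro emb nxt hT
    rw [add_comm, Function.iterate_add_apply]
    simp only [entry]
    rw [ih _ _ fun l => hT (.inl l)]
    exact ih' _ _ fun l => hT (.inr l)
  | @loop_nil k brk f s h =>
    intro emb nxt hT
    have := hT (.inl ())
    simp only [code] at this
    simp only [Function.iterate_one, OracleMachine.step, entry, this, h, List.head?_nil,
      List.tail_nil]
    rw [← h, Function.update_eq_self]
  | @loop_brk k brk f s b w h hb =>
    intro emb nxt hT
    have := hT (.inl ())
    simp only [code] at this
    simp [OracleMachine.step, entry, this, h, hb]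
  | @loop_cons k brk f s b w t s' t' s'' h hb h₁ h₂ ih₁ ih₂ =>
    intro emb nxt hT
    have := hT (.inl ())
    simp only [code] at this
    rw [show 1 + t + t' = t' + (t + 1) by omega, Function.iterate_add_apply,
      Function.iterate_add_apply, Function.iterate_one]
    have e : T.step A ⟨entry (loop k brk f) emb nxt, s⟩ =
        ⟨entry (f b) (fun l => emb (.inr ⟨b, l⟩)) (emb (.inl ())), Function.update s k w⟩ := by
      simp [OracleMachine.step, entry, this, h, hb]
    rw [e, ih₁ _ _ fun l => by simpa only [code] using hT (.inr ⟨b, l⟩)]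
    exact ih₂ emb nxt hT

/-- The machine that executes a program and then accepts if the stack `out` is not empty. -/
noncomputable def machine [DecidableEq K] [Fintype K] (p : StackProg K) (inp out : K) :
    OracleMachine where
  K := K
  Λ := Label p ⊕ Option Bool
  fintypeΛ := haveI := fintypeLabel p; inferInstance
  input := inp
  start := entry p Sum.inl (.inr none)
  instr
    | .inl l => code p Sum.inl (.inr none) l
    | .inr none => .pop out fun o => .inr (some o.isSome)
    | .inr (some b) => .halt b

theorem mem_PRel [DecidableEq K] [Fintype K] {A V : Language Bool} (p : StackProg K) (inp out : K)
    (T : Polynomial ℕ)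
    (h : ∀ w, ∃ t ≤ T.eval w.length, ∃ s',
      Run A p (Function.update (fun _ => []) inp w) t s' ∧ (s' out ≠ [] ↔ w ∈ V)) :
    V ∈ PRel A := by
  refine ⟨machine p inp out, T + 1, fun w => ?_⟩
  obtain ⟨t, ht, s', hr, hs⟩ := h w
  refine ⟨(s' out).head?.isSome, ?_, ?_⟩
  · have h1 := Run.simulate (T := machine p inp out) hr Sum.inl (.inr none) fun l => rfl
    obtain ⟨d, hd⟩ := Nat.exists_eq_add_of_le ht
    have h2 : (T + 1).eval w.length = d + (1 + t) := by simp; omega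
    have h3 : ∀ (d : ℕ) (b : Bool) (s : K → List Bool),
        ((machine p inp out).step A)^[d] ⟨.inr (some b), s⟩ = ⟨.inr (some b), s⟩ := by
      intro d b s
      exact Function.iterate_fixed rfl d
    have h4 : (machine p inp out).step A ⟨.inr none, s'⟩ =
      ⟨.inr (some (s' out).head?.isSome), Function.update s' out (s' out).tail⟩ := rfl
    have h5 : ((machine p inp out).step A)^[(T + 1).eval w.length] ((machine p inp out).init w) =
        ⟨.inr (some (s' out).head?.isSome), Function.update s' out (s' out).tail⟩ := by
      rw [h2, Function.iterate_add_apply, Function.iterate_add_apply, Function.iterate_one]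
      refine (congrArg _ ((congrArg _ h1).trans h4)).trans (h3 _ _ _)
    exact (congrArg _ h5).trans rfl
  · rw [← hs]
    cases s' out <;> simp

end StackProg

/-! ## Decoding sequences of words -/

/-- The first item of an encoded sequence of words, and what follows it. Every word is read as an
encoded sequence: an unfinished last item is closed by the end of the word. -/
def splitItem : List Bool → List Bool × List Bool
  | [] => ([], [])
  | [true] => ([], [])
  | false :: w => ([], w)
  | true :: b :: w => (b :: (splitItem w).1, (splitItem w).2)

/-- The sequence of words encoded by a word. -/
def decWords : List Bool → List (List Bool)
  | [] => []
  | [true] => [[]]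
  | false :: w => [] :: decWords w
  | true :: b :: w => match decWords w with
    | [] => [[b]]
    | x :: l => (b :: x) :: l

def encItem (x : List Bool) : List Bool := (x.flatMap fun b => [true, b]) ++ [false]

theorem encItem_nil : encItem [] = [false] := rfl

theorem encItem_cons (b : Bool) (x : List Bool) : encItem (b :: x) = true :: b :: encItem x := by
  simp [encItem]

theorem encWords_nil : encWords [] = [] := rfl

theorem encWords_cons (x : List Bool) (l : List (List Bool)) :
    encWords (x :: l) = encItem x ++ encWords l := by
  simp [encWords, encItem]

theorem length_encItem (x : List Bool) : (encItem x).length = 2 * x.length + 1 := by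
  induction x with
  | nil => rfl
  | cons b x ih => simp [encItem_cons, ih]; omega

theorem splitItem_encItem_append (x w : List Bool) : splitItem (encItem x ++ w) = (x, w) := by
  induction x with
  | nil => rfl
  | cons b x ih => simp [encItem_cons, splitItem, ih]

theorem decWords_eq_cons : ∀ w : List Bool, w ≠ [] →
    decWords w = (splitItem w).1 :: decWords (splitItem w).2
  | [], h => absurd rfl h
  | [true], _ => rfl
  | false :: w, _ => rfl
  | [true, b], _ => rfl
  | true :: b :: c :: w, _ => by
    have := decWords_eq_cons (c :: w) (by simp)
    rw [decWords, this]
    rfl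

theorem length_splitItem : ∀ w : List Bool,
    2 * (splitItem w).1.length + (splitItem w).2.length ≤ w.length
  | [] => by simp [splitItem]
  | [true] => by simp [splitItem]
  | false :: w => by simp [splitItem]
  | true :: b :: w => by
    have := length_splitItem w
    simp [splitItem]
    omega

theorem length_splitItem_snd_lt : ∀ w : List Bool, w ≠ [] → (splitItem w).2.length < w.length
  | [], h => absurd rfl h
  | [true], _ => by simp [splitItem]
  | false :: w, _ => by simp [splitItem]
  | true :: b :: w, _ => by
    have := length_splitItem w
    simp [splitItem]
    omega

theorem decWords_encWords (l : List (List Bool)) : decWords (encWords l) = l := by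
  induction l with
  | nil => rfl
  | cons x l ih =>
    rw [decWords_eq_cons _ (by simp [encWords_cons, encItem]), encWords_cons,
      splitItem_encItem_append, ih]

theorem encWords_injective : Function.Injective encWords :=
  Function.LeftInverse.injective decWords_encWords

theorem encWords_append (l l' : List (List Bool)) :
    encWords (l ++ l') = encWords l ++ encWords l' := by
  simp [encWords]

theorem length_le_length_encWords (l : List (List Bool)) : l.length ≤ (encWords l).length := by
  induction l with
  | nil => simp
  | cons x l ih => simp only [encWords_cons, List.length_append, length_encItem, List.length_cons]; omega

theorem length_encWords_decWords : ∀ w : List Bool,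
    (encWords (decWords w)).length ≤ w.length + 1
  | [] => by simp [decWords, encWords]
  | [true] => by simp [decWords, encWords]
  | false :: w => by
    have := length_encWords_decWords w
    simp [decWords, encWords_cons, encItem_nil]
    omega
  | [true, b] => by simp [decWords, encWords]
  | true :: b :: c :: w => by
    have := length_encWords_decWords (c :: w)
    rw [decWords, decWords_eq_cons (c :: w) (by simp)]
    rw [decWords_eq_cons (c :: w) (by simp)] at this
    simp [encWords_cons, length_encItem] at this ⊢
    omega

namespace StackProg

/-! ## Basic routines -/

variable {K : Type} [DecidableEq K] {A : Language Bool}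

/-- The program takes the stacks from `s` to `s'` within `n` operations. -/
def Does (A : Language Bool) (p : StackProg K) (s : K → List Bool) (n : ℕ)
    (s' : K → List Bool) : Prop :=
  ∃ t ≤ n, Run A p s t s'

theorem Does.mono {p : StackProg K} {s s' : K → List Bool} {n m : ℕ} (h : Does A p s n s')
    (hnm : n ≤ m) : Does A p s m s' :=
  let ⟨t, ht, hr⟩ := h
  ⟨t, ht.trans hnm, hr⟩

theorem Does.congr {p : StackProg K} {s s' s'' : K → List Bool} {n m : ℕ} (h : Does A p s n s')
    (hs : s' = s'') (hnm : n ≤ m) : Does A p s m s'' :=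
  hs ▸ h.mono hnm

theorem Does.seq {p q : StackProg K} {s s' s'' : K → List Bool} {n m : ℕ} (h : Does A p s n s')
    (h' : Does A q s' m s'') : Does A (p ;; q) s (n + m) s'' :=
  let ⟨t, ht, hr⟩ := h
  let ⟨t', ht', hr'⟩ := h'
  ⟨t + t', add_le_add ht ht', hr.seq hr'⟩

theorem Does.skip (s : K → List Bool) : Does A skip s 0 s := ⟨0, le_rfl, .skip s⟩

theorem Does.push (k : K) (b : Bool) (s : K → List Bool) :
    Does A (push k b) s 1 (Function.update s k (b :: s k)) := ⟨1, le_rfl, .push k b s⟩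

theorem Does.pop {k : K} {f : Option Bool → StackProg K} {s s' : K → List Bool} {n : ℕ}
    (h : Does A (f (s k).head?) (Function.update s k (s k).tail) n s') :
    Does A (pop k f) s (n + 1) s' :=
  let ⟨t, ht, hr⟩ := h
  ⟨1 + t, by omega, hr.pop⟩

open Classical in
theorem Does.query {k : K} {f : Bool → StackProg K} {s s' : K → List Bool} {n : ℕ}
    (h : Does A (f (decide (s k ∈ A))) s n s') : Does A (query k f) s (n + 1) s' :=
  let ⟨t, ht, hr⟩ := h
  ⟨1 + t, by omega, hr.query⟩

theorem Does.loop_nil {k : K} {brk : Bool → Bool} {f : Bool → StackProg K} {s : K → List Bool}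
    (h : s k = []) : Does A (loop k brk f) s 1 s :=
  ⟨1, le_rfl, .loop_nil h⟩

theorem Does.loop_brk {k : K} {brk : Bool → Bool} {f : Bool → StackProg K} {s : K → List Bool}
    {b : Bool} {w : List Bool} (h : s k = b :: w) (hb : brk b = true) :
    Does A (loop k brk f) s 1 (Function.update s k w) :=
  ⟨1, le_rfl, .loop_brk h hb⟩

theorem Does.loop_cons {k : K} {brk : Bool → Bool} {f : Bool → StackProg K}
    {s s' s'' : K → List Bool} {b : Bool} {w : List Bool} {n m : ℕ} (h : s k = b :: w)
    (hb : brk b = false) (h₁ : Does A (f b) (Function.update s k w) n s')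
    (h₂ : Does A (loop k brk f) s' m s'') : Does A (loop k brk f) s (1 + n + m) s'' :=
  let ⟨t, ht, hr⟩ := h₁
  let ⟨t', ht', hr'⟩ := h₂
  ⟨1 + t + t', by omega, .loop_cons h hb hr hr'⟩

theorem update_eq_of_eq {s : K → List Bool} {a : K} {w : List Bool} (h : s a = w) :
    Function.update s a w = s := h ▸ Function.update_eq_self a s

/-- Empty a stack. -/
def clear (a : K) : StackProg K := loop a (fun _ => false) fun _ => skip

theorem does_clear (a : K) : ∀ (w : List Bool) (s : K → List Bool), s a = w →
    Does A (clear a) s (w.length + 1) (Function.update s a [])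
  | [], s, h => (Does.loop_nil h).congr (update_eq_of_eq h).symm (by simp)
  | b :: w, s, h => by
    refine (Does.loop_cons h rfl (Does.skip _)
      (does_clear a w (Function.update s a w) (by simp))).congr ?_ ?_
    · simp
    · simp; omega

/-- Move a stack bit by bit onto another one, which reverses it. -/
def move (a b : K) : StackProg K := loop a (fun _ => false) fun c => push b c

theorem does_move {a b : K} (hab : a ≠ b) : ∀ (w : List Bool) (s : K → List Bool), s a = w →
    Does A (move a b) s (2 * w.length + 1)
      (Function.update (Function.update s a []) b (w.reverse ++ s b))
  | [], s, h => (Does.loop_nil h).congr (by simp [update_eq_of_eq h]) (by simp)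
  | c :: w, s, h => by
    refine (Does.loop_cons h rfl (Does.push _ _ _)
      (does_move hab w _ ?_)).congr ?_ ?_
    · simp [hab]
    · funext k
      by_cases hb : k = b <;> by_cases ha : k = a <;> simp_all [Function.update_apply]
    · simp; omega

/-- Move the first item of an encoded sequence onto another stack, which reverses it. -/
def nextRev (a b : K) : StackProg K :=
  loop a (fun c => !c) fun _ => pop a fun o => match o with
    | none => skip
    | some c => push b c

theorem does_nextRev {a b : K} (hab : a ≠ b) : ∀ (w : List Bool) (s : K → List Bool), s a = w →
    Does A (nextRev a b) s (3 * w.length + 1)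
      (Function.update (Function.update s a (splitItem w).2) b ((splitItem w).1.reverse ++ s b))
  | [], s, h => (Does.loop_nil h).congr (by simp [splitItem, update_eq_of_eq h]) (by simp)
  | [true], s, h => by
    refine (Does.loop_cons h rfl (Does.pop (n := 0) (s' := Function.update s a []) ?_)
      (Does.loop_nil ?_)).congr ?_ ?_
    · simpa using Does.skip _
    · simp
    · simp [splitItem, hab.symm]
    · simp
  | false :: w, s, h => by
    refine (Does.loop_brk h rfl).congr ?_ (by simp)
    simp [splitItem, hab.symm]
  | true :: c :: w, s, h => by
    refine (Does.loop_cons h rfl (Does.pop (n := 1)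
      (s' := Function.update (Function.update s a w) b (c :: s b)) ?_)
      (does_nextRev hab w _ ?_)).congr ?_ ?_
    · simpa [hab, hab.symm] using Does.push b c (A := A) (Function.update s a w)
    · simp [hab]
    · funext k
      by_cases hb : k = b <;> by_cases ha : k = a <;> simp_all [Function.update_apply, splitItem]
    · simp; omega

theorem does_loop_push₂ {a b c : K} (hab : a ≠ b) (hac : a ≠ c) (hbc : b ≠ c) :
    ∀ (w : List Bool) (s : K → List Bool), s a = w →
    Does A (loop a (fun _ => false) fun x => push b x ;; push c x) s (3 * w.length + 1)
      (Function.update (Function.update (Function.update s a []) b (w.reverse ++ s b)) c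
        (w.reverse ++ s c))
  | [], s, h => (Does.loop_nil h).congr (by simp [update_eq_of_eq h]) (by simp)
  | x :: w, s, h => by
    refine (Does.loop_cons h rfl ((Does.push _ _ _).seq (Does.push _ _ _))
      (does_loop_push₂ hab hac hbc w _ ?_)).congr ?_ ?_
    · simp [hab, hac]
    · funext k
      by_cases hb : k = b <;> by_cases ha : k = a <;> by_cases hc : k = c <;>
        simp_all [Function.update_apply]
    · simp; omega

theorem does_loop_encode {a b : K} (hab : a ≠ b) : ∀ (w v d : List Bool) (s : K → List Bool),
    s a = w → s b = encItem v ++ d →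
    Does A (loop a (fun _ => false) fun x => push b x ;; push b true) s (3 * w.length + 1)
      (Function.update (Function.update s a []) b (encItem (w.reverse ++ v) ++ d))
  | [], v, d, s, h, h' => (Does.loop_nil h).congr
      (by simp [update_eq_of_eq h, update_eq_of_eq h']) (by simp)
  | x :: w, v, d, s, h, h' => by
    refine (Does.loop_cons h rfl ((Does.push _ _ _).seq (Does.push _ _ _))
      (does_loop_encode hab w (x :: v) d _ ?_ ?_)).congr ?_ ?_
    · simp [hab]
    · simp [encItem_cons, hab.symm, h']
    · funext k
      by_cases hb : k = b <;> by_cases ha : k = a <;>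
        simp_all [Function.update_apply]
    · simp; omega

end StackProg

/-! ## The stacks of the verifier -/

/-- The stacks of the verifier. -/
inductive Reg : Type
  | inp | inst | cert | rules | D | I | rule | agg
  | pos | neg | x | lst | z | x2 | mis | found
  | ok | bad | qry | J | J2 | rest | tmp
  deriving DecidableEq

instance : Fintype Reg :=
  .ofList [.inp, .inst, .cert, .rules, .D, .I, .rule, .agg, .pos, .neg, .x, .lst, .z,
    .x2, .mis, .found, .ok, .bad, .qry, .J, .J2, .rest, .tmp] fun k => by
    cases k <;> simp

/-- The contents of the stacks of the verifier. -/
structure Stacks : Type where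
  inp : List Bool := []
  inst : List Bool := []
  cert : List Bool := []
  rules : List Bool := []
  D : List Bool := []
  I : List Bool := []
  rule : List Bool := []
  agg : List Bool := []
  pos : List Bool := []
  neg : List Bool := []
  x : List Bool := []
  lst : List Bool := []
  z : List Bool := []
  x2 : List Bool := []
  mis : List Bool := []
  found : List Bool := []
  ok : List Bool := []
  bad : List Bool := []
  qry : List Bool := []
  J : List Bool := []
  J2 : List Bool := []
  rest : List Bool := []
  tmp : List Bool := []

namespace Stacks

def get (r : Stacks) : Reg → List Bool
  | .inp => r.inp
  | .inst => r.inst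
  | .cert => r.cert
  | .rules => r.rules
  | .D => r.D
  | .I => r.I
  | .rule => r.rule
  | .agg => r.agg
  | .pos => r.pos
  | .neg => r.neg
  | .x => r.x
  | .lst => r.lst
  | .z => r.z
  | .x2 => r.x2
  | .mis => r.mis
  | .found => r.found
  | .ok => r.ok
  | .bad => r.bad
  | .qry => r.qry
  | .J => r.J
  | .J2 => r.J2
  | .rest => r.rest
  | .tmp => r.tmp

def set (r : Stacks) : Reg → List Bool → Stacks
  | .inp, w => { r with inp := w }
  | .inst, w => { r with inst := w }
  | .cert, w => { r with cert := w }
  | .rules, w => { r with rules := w }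
  | .D, w => { r with D := w }
  | .I, w => { r with I := w }
  | .rule, w => { r with rule := w }
  | .agg, w => { r with agg := w }
  | .pos, w => { r with pos := w }
  | .neg, w => { r with neg := w }
  | .x, w => { r with x := w }
  | .lst, w => { r with lst := w }
  | .z, w => { r with z := w }
  | .x2, w => { r with x2 := w }
  | .mis, w => { r with mis := w }
  | .found, w => { r with found := w }
  | .ok, w => { r with ok := w }
  | .bad, w => { r with bad := w }
  | .qry, w => { r with qry := w }
  | .J, w => { r with J := w }
  | .J2, w => { r with J2 := w }
  | .rest, w => { r with rest := w }
  | .tmp, w => { r with tmp := w }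

theorem update_get (r : Stacks) (k : Reg) (w : List Bool) :
    Function.update r.get k w = (r.set k w).get := by
  funext j
  cases k <;> cases j <;> rfl

end Stacks

namespace StackProg

variable {A : Language Bool} {N : ℕ}

theorem Does.conv {p : StackProg Reg} {r r' q q' : Stacks} {n m : ℕ}
    (h : Does A p r.get n q.get) (hr : r' = r) (hq : q = q') (hnm : n ≤ m) :
    Does A p r'.get m q'.get := by
  subst hr hq
  exact h.mono hnm

/-- Move the first item of the sequence on `a` to `b`. -/
def next (a b : Reg) : StackProg Reg := nextRev a .tmp ;; move .tmp b

theorem does_next (a b : Reg) (r : Stacks) (ha : a ≠ .tmp) (hb : b ≠ .tmp) (hab : a ≠ b)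
    (ht : r.get .tmp = []) (hb' : r.get b = []) (hn : (r.get a).length < N) :
    Does A (next a b) r.get (5 * N)
      ((r.set a (splitItem (r.get a)).2).set b (splitItem (r.get a)).1).get := by
  refine ((does_nextRev ha _ _ rfl).seq (does_move hb.symm _ _ rfl)).congr ?_ ?_
  · rw [← Stacks.update_get, ← Stacks.update_get]
    have := hab.symm
    funext k
    by_cases h1 : k = b <;> by_cases h2 : k = .tmp <;> by_cases h3 : k = a <;>
      simp_all
  · have := length_splitItem (r.get a)
    simp [ht]
    omega

/-- Move the word on `a` as an item to the front of the sequence on `b`. -/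
def put (a b : Reg) : StackProg Reg :=
  move a .tmp ;; push b false ;; loop .tmp (fun _ => false) fun x => push b x ;; push b true

theorem does_put (a b : Reg) (r : Stacks) (ha : a ≠ .tmp) (hb : b ≠ .tmp) (hab : a ≠ b)
    (ht : r.get .tmp = []) (hn : (r.get a).length < N) :
    Does A (put a b) r.get (5 * N) ((r.set a []).set b (encItem (r.get a) ++ r.get b)).get := by
  refine ((does_move ha _ _ rfl).seq ((Does.push _ _ _).seq
    (does_loop_encode hb.symm _ [] (r.get b) _ rfl ?_))).congr ?_ ?_
  · simp [hb, hab.symm, encItem_nil]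
  · rw [← Stacks.update_get, ← Stacks.update_get]
    have h0 := hab.symm
    have h0' := hb.symm
    funext k
    by_cases h1 : k = b <;> by_cases h2 : k = .tmp <;> by_cases h3 : k = a <;>
      simp_all
  · simp [ht, hb.symm]
    omega

/-- Copy the word on `a` to the front of the word on `b`. -/
def copy (a b : Reg) : StackProg Reg :=
  move a .tmp ;; loop .tmp (fun _ => false) fun x => push a x ;; push b x

theorem does_copy (a b : Reg) (r : Stacks) (ha : a ≠ .tmp) (hb : b ≠ .tmp) (hab : a ≠ b)
    (ht : r.get .tmp = []) (hn : (r.get a).length < N) :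
    Does A (copy a b) r.get (5 * N) (r.set b (r.get a ++ r.get b)).get := by
  refine ((does_move ha _ _ rfl).seq
    (does_loop_push₂ ha.symm hb.symm hab _ _ rfl)).congr ?_ ?_
  · rw [← Stacks.update_get]
    have := hab.symm
    funext k
    by_cases h1 : k = b <;> by_cases h2 : k = .tmp <;> by_cases h3 : k = a <;>
      simp_all
  · simp [ht]
    omega

theorem does_clear_get (a : Reg) (r : Stacks) (hn : (r.get a).length < N) :
    Does A (clear a) r.get N (r.set a []).get :=
  (does_clear a _ _ rfl).congr (r.update_get _ _) hn

def flag (c : Bool) : List Bool := if c then [true] else []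

def setFlag (a : Reg) : StackProg Reg := pop a fun _ => push a true

theorem does_setFlag (a : Reg) (r : Stacks) {c : Bool} (h : r.get a = flag c) :
    Does A (setFlag a) r.get 2 (r.set a (flag true)).get := by
  refine (Does.pop (Does.push _ _ _)).congr ?_ le_rfl
  rw [← Stacks.update_get]
  cases c <;> simp [h, flag]

/-- Execute `body` for every item of the sequence on `a`, with the item on `b`. -/
def forItems (a b : Reg) (body : StackProg Reg) : StackProg Reg :=
  loop a (fun _ => false) fun c => push a c ;; next a b ;; body

theorem does_forItems {α : Type} {a b : Reg} {body : StackProg Reg}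
    (st : List Bool → α → Stacks) (F : α → List Bool → α) {T : ℕ}
    (ha : a ≠ .tmp) (hb : b ≠ .tmp) (hab : a ≠ b)
    (hget : ∀ w i, (st w i).get a = w) (hset : ∀ w w' i, (st w i).set a w' = st w' i)
    (hb' : ∀ w i, (st w i).get b = []) (ht : ∀ w i, (st w i).get .tmp = [])
    (hbody : ∀ w i v, v.length < N →
      Does A body ((st w i).set b v).get T (st w (F i v)).get)
    (w : List Bool) (i : α) (hw : w.length < N) :
    Does A (forItems a b body) (st w i).get (N * (T + 7 * N))
      (st [] ((decWords w).foldl F i)).get := by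
  suffices h : ∀ (n : ℕ) (w : List Bool) (i : α), w.length = n → w.length < N →
      Does A (forItems a b body) (st w i).get (w.length * (T + 7 * N) + 1)
        (st [] ((decWords w).foldl F i)).get from by
    refine (h _ w i rfl hw).mono ?_
    have h1 : (w.length + 1) * (T + 7 * N) ≤ N * (T + 7 * N) := Nat.mul_le_mul_right _ hw
    rw [Nat.succ_mul] at h1
    omega
  intro n
  induction n using Nat.strong_induction_on with
  | _ n ih =>
    intro w i hn hw
    rcases w with _ | ⟨c, w⟩
    · exact (Does.loop_nil (hget _ _)).mono (by simp)
    · have hne : c :: w ≠ [] := by simp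
      have hlt := length_splitItem_snd_lt _ hne
      have hle := length_splitItem (c :: w)
      have h1 := ih _ (hn ▸ hlt) (splitItem (c :: w)).2 (F i (splitItem (c :: w)).1) rfl
        (hlt.trans hw)
      rw [decWords_eq_cons _ hne, List.foldl_cons]
      refine (Does.loop_cons (hget _ _) rfl (n := 1 + (5 * N + T)) ?_ h1).mono ?_
      · refine Does.seq (Does.push _ _ _) ?_
        simp only [Stacks.update_get, hget, hset]
        refine Does.seq (does_next a b _ ha hb hab (ht _ _) (hb' _ _) (by rwa [hget])) ?_
        simp only [hget, hset]
        exact hbody _ _ _ (by omega)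
      · have : ((splitItem (c :: w)).2.length + 1) * (T + 7 * N) ≤ (c :: w).length * (T + 7 * N) :=
          Nat.mul_le_mul_right _ hlt
        rw [Nat.succ_mul] at this
        omega

end StackProg

namespace StackProg

variable {A : Language Bool} {N : ℕ}

/-! ## The verifier -/

theorem foldl_or {α : Type} (p : α → Bool) (l : List α) (c : Bool) :
    l.foldl (fun c v => c || p v) c = (c || l.any p) := by
  induction l generalizing c with
  | nil => simp
  | cons v l ih => simp [ih, Bool.or_assoc]

/-- Pop the flag `a` and branch on it. -/
def ifFlag (a : Reg) (p q : StackProg Reg) : StackProg Reg :=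
  pop a fun o => match o with
    | none => q
    | some _ => p

theorem does_ifFlag {a : Reg} {p q : StackProg Reg} (r : Stacks) {s : Reg → List Bool} {n : ℕ}
    (c : Bool) (h : r.get a = flag c)
    (h' : Does A (if c then p else q) (r.set a []).get n s) :
    Does A (ifFlag a p q) r.get (n + 1) s := by
  refine Does.pop ?_
  rw [Stacks.update_get, h]
  cases c <;> simpa [flag] using h'

/-- Compare the word on `z` with that on `x`, and set the flag `found` if they are equal. -/
def eqTest : StackProg Reg :=
  copy .x .x2 ;;
  loop .z (fun _ => false) (fun b => pop .x2 fun o =>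
    if o = some b then skip else setFlag .mis) ;;
  (pop .x2 fun o => match o with
    | none => skip
    | some _ => setFlag .mis ;; clear .x2) ;;
  ifFlag .mis skip (setFlag .found)

theorem does_compare : ∀ (z : List Bool) (r : Stacks) (c : Bool), r.z = z → r.mis = flag c →
    Does A (loop .z (fun _ => false) (fun b => pop .x2 fun o =>
      if o = some b then skip else setFlag .mis)) r.get (4 * z.length + 1)
      { r with z := [], x2 := r.x2.drop z.length, mis := flag (c || !z.isPrefixOf r.x2) }.get
  | [], r, c, hz, hm => by
    refine (Does.loop_nil (show r.get .z = [] from hz)).congr ?_ (by simp)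
    cases r
    simp_all
  | b :: z, r, c, hz, hm => by
    have hbody : Does A (pop .x2 fun o => if o = some b then skip else setFlag .mis)
        { r with z := z }.get 3
        { r with z := z, x2 := r.x2.tail, mis := flag (c || !(r.x2.head? == some b)) }.get := by
      refine (Does.pop (n := 2) ?_)
      rw [Stacks.update_get]
      by_cases h : r.x2.head? = some b
      · simp only [Stacks.get, h, if_true]
        refine (Does.skip _).congr ?_ (by simp)
        cases r
        simp_all [Stacks.set]
      · simp only [Stacks.get, h, if_false]
        refine (does_setFlag .mis (c := c) _ (by exact hm)).congr ?_ le_rfl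
        have : (r.x2.head? == some b) = false := by simpa using h
        simp [this, Stacks.set]
    have hz' : r.get .z = b :: z := hz
    have h1 := does_compare z { r with
      z := z, x2 := r.x2.tail, mis := flag (c || !(r.x2.head? == some b)) } _ rfl rfl
    refine (Does.loop_cons hz' rfl (by rw [Stacks.update_get]; exact hbody) h1).congr ?_ ?_
    · congr 2
      · simp
      · congr 1
        rcases r.x2 with _ | ⟨b', x⟩
        · simp
        · simp only [List.head?_cons, Option.some_beq_some, List.tail_cons, List.isPrefixOf]
          cases c <;> cases b <;> cases b' <;> simp
    · simp; omega

theorem does_eqTest (r : Stacks) (c : Bool) (h1 : r.tmp = []) (h2 : r.x2 = []) (h3 : r.mis = [])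
    (h4 : r.found = flag c) (hx : r.x.length < N) (hz : r.z.length < N) :
    Does A eqTest r.get (16 * N) { r with
      z := [], found := flag (c || decide (r.z = r.x)) }.get := by
  cases r
  rename_i inp inst cert rules D I rule agg pos neg x lst z x2 mis found ok bad qry J J2 rest tmp
  dsimp only at *
  subst h1 h2 h3 h4
  refine Does.mono (Does.seq (does_copy .x .x2 _ (by decide) (by decide) (by decide) rfl hx) (Does.seq
    (does_compare _ _ false rfl rfl) (Does.seq (n := N + 3) (s' := ?_) (m := 3) ?_ ?_)))
    (n := 5 * N + ((4 * z.length + 1) + ((N + 3) + 3))) ?_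
  · exact (Stacks.mk inp inst cert rules D I rule agg pos neg x lst [] []
      (flag (!decide (z = x))) (flag c) ok bad qry J J2 rest []).get
  · refine Does.pop (n := N + 2) ?_
    rw [Stacks.update_get]
    simp only [Stacks.get, Stacks.set, List.append_nil]
    rcases h : x.drop z.length with _ | ⟨b, v⟩
    · refine (Does.skip _).congr ?_ (by simp)
      have : decide (z = x) = z.isPrefixOf x := by
        rw [Bool.eq_iff_iff]
        simp only [decide_eq_true_eq, List.isPrefixOf_iff_prefix]
        constructor
        · rintro rfl; exact List.prefix_rfl
        · rintro ⟨t, rfl⟩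
          simp at h
          simp [h]
      simp [this]
    · have h0 : v.length < N := by
        have := congrArg List.length h
        simp at this
        omega
      refine ((does_setFlag .mis (c := (!z.isPrefixOf x)) _ (by simp [Stacks.get])).seq
        (does_clear_get (N := N) _ _ (by exact h0))).congr ?_ (by omega)
      have : z ≠ x := by
        rintro rfl
        simp at h
      simp [Stacks.set, this]
  · refine does_ifFlag (n := 2) _ (!decide (z = x)) rfl ?_
    by_cases hzx : z = x
    · simp only [hzx, decide_true, Bool.not_true, if_false, Bool.or_true, Bool.false_eq_true]
      exact does_setFlag .found (c := c) _ rfl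
    · simp only [hzx, decide_false, Bool.not_false, if_true, Bool.or_false]
      exact (Does.skip _).mono (by simp)
  · omega

/-- Set the flag `found` if the word on `x` is among the items on `lst`. -/
def member : StackProg Reg := forItems .lst .z eqTest

theorem does_member (r : Stacks) (l : List (List Bool)) (h1 : r.tmp = [])
    (h2 : r.x2 = []) (h3 : r.mis = []) (h4 : r.found = []) (h5 : r.z = [])
    (hl : r.lst = encWords l) (hx : r.x.length < N) (hn : (encWords l).length < N) :
    Does A member r.get (23 * N ^ 2) { r with
      lst := [], found := flag (decide (r.x ∈ l)) }.get := by
  have := does_forItems (A := A) (a := .lst) (b := .z) (body := eqTest) (N := N)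
    (fun w c => { r with lst := w, found := flag c }) (fun c v => c || decide (v = r.x))
    (T := 16 * N) (by decide) (by decide) (by decide) (fun _ _ => rfl) (fun _ _ _ => rfl)
    (fun _ _ => h5) (fun _ _ => h1)
    (fun w c v hv => (does_eqTest (Stacks.set { r with lst := w, found := flag c } .z v) c
      h1 h2 h3 rfl hx hv).conv rfl (by cases r; simp_all [Stacks.set]) le_rfl)
    (encWords l) false hn
  rw [foldl_or, decWords_encWords] at this
  refine this.conv (by cases r; simp_all [flag]) ?_ (by apply le_of_eq; ring)
  congr 2
  rw [Bool.eq_iff_iff]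
  simp

/-- Move every item on `lst` to `J` or to `rest`, as the bits on `cert` say. -/
def distribute : StackProg Reg :=
  forItems .lst .x (pop .cert fun o => if o = some true then put .x .J else put .x .rest)

/-- Distribute a word to one of two lists, as the first bit of a certificate says. -/
def chooseList (i : List Bool × List (List Bool) × List (List Bool)) (v : List Bool) :
    List Bool × List (List Bool) × List (List Bool) :=
  if i.1.head? = some true then (i.1.tail, v :: i.2.1, i.2.2) else (i.1.tail, i.2.1, v :: i.2.2)

theorem does_distribute (r : Stacks) (w y : List Bool) (a b : List (List Bool)) (h1 : r.tmp = [])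
    (h2 : r.x = []) (h3 : r.lst = w) (h4 : r.cert = y) (h5 : r.J = encWords a)
    (h6 : r.rest = encWords b) (hw : w.length < N) :
    Does A distribute r.get (13 * N ^ 2) { r with
      lst := []
      cert := ((decWords w).foldl chooseList (y, a, b)).1
      J := encWords ((decWords w).foldl chooseList (y, a, b)).2.1
      rest := encWords ((decWords w).foldl chooseList (y, a, b)).2.2 }.get := by
  have := does_forItems (A := A) (a := .lst) (b := .x) (N := N)
    (body := pop .cert fun o => if o = some true then put .x .J else put .x .rest)
    (fun w (i : List Bool × List (List Bool) × List (List Bool)) =>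
      { r with lst := w, cert := i.1, J := encWords i.2.1, rest := encWords i.2.2 }) chooseList
    (T := 6 * N) (by decide) (by decide) (by decide) (fun _ _ => rfl) (fun _ _ _ => rfl)
    (fun _ _ => h2) (fun _ _ => h1)
    (fun w i v hv => by
      refine (Does.pop (n := 5 * N) ?_).mono (by omega)
      rw [Stacks.update_get]
      simp only [Stacks.get, Stacks.set]
      by_cases h : i.1.head? = some true
      · simp only [h, if_true, chooseList]
        refine (does_put .x .J _ (by decide) (by decide) (by decide) (by exact h1) (by exact hv)).congr ?_ le_rfl
        cases r; simp_all [Stacks.set, Stacks.get, encWords_cons]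
      · simp only [h, if_false, chooseList]
        refine (does_put .x .rest _ (by decide) (by decide) (by decide) (by exact h1) (by exact hv)).congr ?_ le_rfl
        cases r; simp_all [Stacks.set, Stacks.get, encWords_cons])
    w (y, a, b) hw
  exact this.conv (by cases r; simp_all) rfl (by apply le_of_eq; ring)

end StackProg

/-- The auxiliary stacks of the tests are empty. -/
structure Stacks.Clean (r : Stacks) : Prop where
  tmp : r.tmp = []
  x2 : r.x2 = []
  mis : r.mis = []
  found : r.found = []
  z : r.z = []
  lst : r.lst = []

namespace StackProg

variable {A : Language Bool} {N : ℕ}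

/-- Set the flag `ok` if the word on `x` is among the items on `I` and `D`; empty `x`. -/
def testNeg : StackProg Reg :=
  copy .D .lst ;; copy .I .lst ;; member ;; ifFlag .found (setFlag .ok) skip ;; clear .x

/-- Set the flag `ok` if the word on `x` is not among the items on `I`; empty `x`. -/
def testPos : StackProg Reg :=
  copy .I .lst ;; member ;; ifFlag .found skip (setFlag .ok) ;; clear .x

/-- Set the flag `ok` if the word on `x` is among the items on `I`; empty `x`. -/
def testHead : StackProg Reg :=
  copy .I .lst ;; member ;; ifFlag .found (setFlag .ok) skip ;; clear .x

/-- Set the flag `ok` if the oracle says that the aggregate on `x` is false in `J`; empty `x`. -/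
def testAgg : StackProg Reg :=
  copy .J .J2 ;; put .J2 .qry ;; put .x .qry ;;
  query .qry (fun b => if b then skip else setFlag .ok) ;; clear .qry

theorem does_ifFlag_setFlag (r : Stacks) (c d : Bool) (h : r.found = flag d)
    (h' : r.ok = flag c) :
    Does A (ifFlag .found (setFlag .ok) skip) r.get 3
      { r with found := [], ok := flag (c || d) }.get := by
  refine does_ifFlag (n := 2) r d h ?_
  cases d
  · refine (Does.skip _).congr ?_ (by simp)
    cases r; simp_all [Stacks.set]
  · simp only [if_true, Bool.or_true]
    exact does_setFlag .ok (c := c) _ (by exact h')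

theorem does_ifFlag_setFlag_not (r : Stacks) (c d : Bool) (h : r.found = flag d)
    (h' : r.ok = flag c) :
    Does A (ifFlag .found skip (setFlag .ok)) r.get 3
      { r with found := [], ok := flag (c || !d) }.get := by
  refine does_ifFlag (n := 2) r d h ?_
  cases d
  · simp only [Bool.false_eq_true, if_false, Bool.not_false, Bool.or_true]
    exact does_setFlag .ok (c := c) _ (by exact h')
  · refine (Does.skip _).congr ?_ (by simp)
    cases r; simp_all [Stacks.set]

theorem le_sq_and_one_le_of_lt {N m : ℕ} (h : m < N) : N ≤ N ^ 2 ∧ 1 ≤ N := by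
  constructor <;> nlinarith

theorem does_testHead (r : Stacks) (I : List (List Bool)) (c : Bool) (hr : r.Clean)
    (hI : r.I = encWords I) (hok : r.ok = flag c) (hx : r.x.length < N)
    (hn : (encWords I).length < N) :
    Does A testHead r.get (37 * N ^ 2)
      { r with x := [], ok := flag (c || decide (r.x ∈ I)) }.get := by
  obtain ⟨h1, h2, h3, h4, h5, h6⟩ := hr
  cases r
  dsimp only at *
  subst h1 h2 h3 h4 h5 h6 hI hok
  refine Does.mono (Does.seq (does_copy .I .lst _ (by decide) (by decide) (by decide) rfl (by exact hn))
    (Does.seq (does_member (N := N) _ I rfl rfl rfl rfl rfl (by exact List.append_nil _)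
      (by exact hx) hn) (Does.seq (does_ifFlag_setFlag _ c _ rfl rfl)
      (does_clear_get .x _ (by exact hx))))) ?_
  have := le_sq_and_one_le_of_lt hn
  omega

theorem does_testPos (r : Stacks) (I : List (List Bool)) (c : Bool) (hr : r.Clean)
    (hI : r.I = encWords I) (hok : r.ok = flag c) (hx : r.x.length < N)
    (hn : (encWords I).length < N) :
    Does A testPos r.get (37 * N ^ 2)
      { r with x := [], ok := flag (c || !decide (r.x ∈ I)) }.get := by
  obtain ⟨h1, h2, h3, h4, h5, h6⟩ := hr
  cases r
  dsimp only at *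
  subst h1 h2 h3 h4 h5 h6 hI hok
  refine Does.mono (Does.seq (does_copy .I .lst _ (by decide) (by decide) (by decide) rfl (by exact hn))
    (Does.seq (does_member (N := N) _ I rfl rfl rfl rfl rfl (by exact List.append_nil _)
      (by exact hx) hn) (Does.seq (does_ifFlag_setFlag_not _ c _ rfl rfl)
      (does_clear_get .x _ (by exact hx))))) ?_
  have := le_sq_and_one_le_of_lt hn
  omega

theorem does_testNeg (r : Stacks) (D I : List (List Bool)) (c : Bool) (hr : r.Clean)
    (hD : r.D = encWords D) (hI : r.I = encWords I) (hok : r.ok = flag c) (hx : r.x.length < N)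
    (hn : (encWords (I ++ D)).length < N) :
    Does A testNeg r.get (37 * N ^ 2)
      { r with x := [], ok := flag (c || decide (r.x ∈ I ++ D)) }.get := by
  obtain ⟨h1, h2, h3, h4, h5, h6⟩ := hr
  cases r
  dsimp only at *
  subst h1 h2 h3 h4 h5 h6 hD hI hok
  have hn' := hn
  rw [encWords_append, List.length_append] at hn'
  refine Does.mono (Does.seq (does_copy .D .lst _ (by decide) (by decide) (by decide) rfl
      (show (encWords D).length < N by omega))
    (Does.seq (does_copy .I .lst _ (by decide) (by decide) (by decide) rfl
      (show (encWords I).length < N by omega))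
    (Does.seq (does_member (N := N) _ (I ++ D) rfl rfl rfl rfl rfl
      (by simp [Stacks.set, Stacks.get, encWords_append])
      (by exact hx) hn) (Does.seq (does_ifFlag_setFlag _ c _ rfl rfl)
      (does_clear_get .x _ (by exact hx)))))) ?_
  have := le_sq_and_one_le_of_lt hn
  omega

open Classical in
theorem does_testAgg (r : Stacks) (J : List (List Bool)) (c : Bool) (h1 : r.tmp = [])
    (h2 : r.J2 = []) (h3 : r.qry = []) (hJ : r.J = encWords J) (hok : r.ok = flag c)
    (hx : r.x.length < N) (hn : (encWords J).length < N) :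
    Does A testAgg r.get (22 * N)
      { r with x := [], ok := flag (c || !decide (encWords [r.x, encWords J] ∈ A)) }.get := by
  cases r
  rename_i inp inst cert rules D I rule agg pos neg x lst z x2 mis found ok bad qry J' J2 rest tmp
  dsimp only at *
  subst h1 h2 h3 hJ hok
  have hq : encWords [x, encWords J] = encItem x ++ (encItem (encWords J ++ []) ++ []) := by
    simp [encWords_cons, encWords_nil]
  refine Does.mono (Does.seq (does_copy .J .J2 _ (by decide) (by decide) (by decide) rfl (by exact hn))
    (Does.seq (does_put .J2 .qry (N := N) _ (by decide) (by decide) (by decide) rfl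
      (by simpa [Stacks.set, Stacks.get] using hn))
    (Does.seq (does_put .x .qry (N := N) _ (by decide) (by decide) (by decide) rfl (by exact hx))
    (Does.seq (n := 3) (Does.query (n := 2) ?_)
      (does_clear_get .qry (N := 4 * N) ⟨inp, inst, cert, rules, D, I, rule, agg, pos, neg, [],
        lst, z, x2, mis, found, flag (c || !decide (encWords [x, encWords J] ∈ A)), bad,
        encWords [x, encWords J], encWords J, [], rest, []⟩ ?_))))) ?_
  · rw [hq]
    simp only [Stacks.get, Stacks.set]
    by_cases h : encItem x ++ (encItem (encWords J ++ []) ++ []) ∈ A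
    · simp only [h, decide_true, if_true, Bool.not_true, Bool.or_false]
      exact (Does.skip _).mono (by simp)
    · simp only [h, decide_false, Bool.false_eq_true, if_false, Bool.not_false, Bool.or_true]
      exact does_setFlag .ok (c := c) _ rfl
  · rw [hq]
    simp [Stacks.get, length_encItem]
    omega
  · omega

theorem does_forItems_testNeg (r : Stacks) (D I : List (List Bool)) (c : Bool) (hr : r.Clean)
    (hx : r.x = []) (hD : r.D = encWords D) (hI : r.I = encWords I) (hok : r.ok = flag c)
    (hw : r.neg.length < N) (hn : (encWords (I ++ D)).length < N) :
    Does A (forItems .neg .x testNeg) r.get (44 * N ^ 3) { r with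
      neg := [], ok := flag (c || (decWords r.neg).any fun u => decide (u ∈ I ++ D)) }.get := by
  have := does_forItems (A := A) (a := .neg) (b := .x) (body := testNeg) (N := N)
    (fun w c => { r with neg := w, ok := flag c }) (fun c v => c || decide (v ∈ I ++ D))
    (T := 37 * N ^ 2) (by decide) (by decide) (by decide) (fun _ _ => rfl) (fun _ _ _ => rfl)
    (fun _ _ => hx) (fun _ _ => hr.tmp)
    (fun w c v hv => (does_testNeg (Stacks.set { r with neg := w, ok := flag c } .x v) D I c
      ⟨hr.tmp, hr.x2, hr.mis, hr.found, hr.z, hr.lst⟩ hD hI rfl hv hn).conv rfl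
      (by cases r; simp_all [Stacks.set]) le_rfl)
    r.neg c hw
  rw [foldl_or] at this
  exact this.conv (by cases r; simp_all) rfl (by have := le_sq_and_one_le_of_lt hn; nlinarith)

theorem does_forItems_testPos (r : Stacks) (I : List (List Bool)) (c : Bool) (hr : r.Clean)
    (hx : r.x = []) (hI : r.I = encWords I) (hok : r.ok = flag c)
    (hw : r.pos.length < N) (hn : (encWords I).length < N) :
    Does A (forItems .pos .x testPos) r.get (44 * N ^ 3) { r with
      pos := [], ok := flag (c || (decWords r.pos).any fun u => !decide (u ∈ I)) }.get := by
  have := does_forItems (A := A) (a := .pos) (b := .x) (body := testPos) (N := N)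
    (fun w c => { r with pos := w, ok := flag c }) (fun c v => c || !decide (v ∈ I))
    (T := 37 * N ^ 2) (by decide) (by decide) (by decide) (fun _ _ => rfl) (fun _ _ _ => rfl)
    (fun _ _ => hx) (fun _ _ => hr.tmp)
    (fun w c v hv => (does_testPos (Stacks.set { r with pos := w, ok := flag c } .x v) I c
      ⟨hr.tmp, hr.x2, hr.mis, hr.found, hr.z, hr.lst⟩ hI rfl hv hn).conv rfl
      (by cases r; simp_all [Stacks.set]) le_rfl)
    r.pos c hw
  rw [foldl_or] at this
  exact this.conv (by cases r; simp_all) rfl (by have := le_sq_and_one_le_of_lt hn; nlinarith)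

open Classical in
theorem does_forItems_testAgg (r : Stacks) (J : List (List Bool)) (c : Bool) (h1 : r.tmp = [])
    (h2 : r.J2 = []) (h3 : r.qry = []) (hx : r.x = []) (hJ : r.J = encWords J)
    (hok : r.ok = flag c) (hw : r.agg.length < N) (hn : (encWords J).length < N) :
    Does A (forItems .agg .x testAgg) r.get (29 * N ^ 2) { r with
      agg := []
      ok := flag (c || (decWords r.agg).any fun u =>
        !decide (encWords [u, encWords J] ∈ A)) }.get := by
  have := does_forItems (A := A) (a := .agg) (b := .x) (body := testAgg) (N := N)
    (fun w c => { r with agg := w, ok := flag c })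
    (fun c v => c || !decide (encWords [v, encWords J] ∈ A))
    (T := 22 * N) (by decide) (by decide) (by decide) (fun _ _ => rfl) (fun _ _ _ => rfl)
    (fun _ _ => hx) (fun _ _ => h1)
    (fun w c v hv => (does_testAgg (Stacks.set { r with agg := w, ok := flag c } .x v) J c
      h1 h2 h3 hJ rfl hv hn).conv rfl (by cases r; simp_all [Stacks.set]) le_rfl)
    r.agg c hw
  rw [foldl_or] at this
  exact this.conv (by cases r; simp_all) rfl (by apply le_of_eq; ring)

/-- Check the rule on `rule`: set the flag `bad` if its head is not among the items on `I`,
although its body is not refuted by the items on `D` and `I` and by the certificate. -/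
def checkRule : StackProg Reg :=
  next .rule .x ;; testHead ;; next .rule .agg ;; next .rule .pos ;; next .rule .neg ;;
  clear .rule ;; forItems .neg .x testNeg ;; forItems .pos .x testPos ;;
  copy .D .lst ;; copy .I .J ;; distribute ;; clear .rest ;;
  forItems .agg .x testAgg ;; clear .J ;; ifFlag .ok skip (setFlag .bad)

/-- The rule encoded by `v` does not derive an atom outside `I`. -/
noncomputable def ruleOK (A : Language Bool) (D I J : List (List Bool)) (v : List Bool) : Bool :=
  let v₁ := (splitItem v).2
  let v₂ := (splitItem v₁).2
  let v₃ := (splitItem v₂).2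
  decide ((splitItem v).1 ∈ I)
    || (decWords (splitItem v₃).1).any (fun u => decide (u ∈ I ++ D))
    || (decWords (splitItem v₂).1).any (fun u => !decide (u ∈ I))
    || (decWords (splitItem v₁).1).any
        (open Classical in fun u => !decide (encWords [u, encWords J] ∈ A))

theorem length_encWords_chooseList (l : List (List Bool))
    (i : List Bool × List (List Bool) × List (List Bool)) :
    (encWords (l.foldl chooseList i).2.1).length + (encWords (l.foldl chooseList i).2.2).length =
      (encWords i.2.1).length + (encWords i.2.2).length + (encWords l).length := by
  induction l generalizing i with
  | nil => simp [encWords_nil]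
  | cons v l ih =>
    rw [List.foldl_cons, ih, chooseList]
    split <;> simp [encWords_cons] <;> omega

theorem does_checkRule (r : Stacks) (D I : List (List Bool)) (bad : Bool) (hr : r.Clean)
    (hx : r.x = []) (hagg : r.agg = []) (hpos : r.pos = []) (hneg : r.neg = []) (hJ : r.J = [])
    (hJ2 : r.J2 = []) (hqry : r.qry = []) (hrest : r.rest = []) (hok : r.ok = [])
    (hD : r.D = encWords D) (hI : r.I = encWords I) (hbad : r.bad = flag bad)
    (hv : r.rule.length < N) (hn : (encWords (I ++ D)).length < N) :
    Does A checkRule r.get (250 * N ^ 3) { r with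
      rule := []
      cert := (D.foldl chooseList (r.cert, I, [])).1
      bad := flag (bad || !ruleOK A D I (D.foldl chooseList (r.cert, I, [])).2.1 r.rule) }.get := by
  obtain ⟨h1, h2, h3, h4, h5, h6⟩ := hr
  cases r
  rename_i inp inst cert rules D' I' rule agg pos neg x lst z x2 mis found ok bad' qry J' J2 rest tmp
  dsimp only at *
  subst h1 h2 h3 h4 h5 h6 hx hagg hpos hneg hJ hJ2 hqry hrest hok hD hI hbad
  have hn' := hn
  rw [encWords_append, List.length_append] at hn'
  have hDN : (encWords D).length < N := by omega
  have hIN : (encWords I).length < N := by omega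
  have hchoose := length_encWords_chooseList D (cert, I, [])
  simp only [encWords_nil, List.length_nil] at hchoose
  have l0 := length_splitItem rule
  have l1 := length_splitItem (splitItem rule).2
  have l2 := length_splitItem (splitItem (splitItem rule).2).2
  have l3 := length_splitItem (splitItem (splitItem (splitItem rule).2).2).2
  refine Does.mono
    (Does.seq (does_next .rule .x _ (by decide) (by decide) (by decide) rfl rfl (by exact hv))
    (Does.seq (does_testHead _ I false ⟨rfl, rfl, rfl, rfl, rfl, rfl⟩ rfl rfl
      (show (splitItem rule).1.length < N by omega) hIN)
    (Does.seq (does_next .rule .agg _ (by decide) (by decide) (by decide) rfl rfl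
      (show (splitItem rule).2.length < N by omega))
    (Does.seq (does_next .rule .pos _ (by decide) (by decide) (by decide) rfl rfl
      (show (splitItem (splitItem rule).2).2.length < N by omega))
    (Does.seq (does_next .rule .neg _ (by decide) (by decide) (by decide) rfl rfl
      (show (splitItem (splitItem (splitItem rule).2).2).2.length < N by omega))
    (Does.seq (does_clear_get .rule _
      (show (splitItem (splitItem (splitItem (splitItem rule).2).2).2).2.length < N by omega))
    (Does.seq (does_forItems_testNeg _ D I _ ⟨rfl, rfl, rfl, rfl, rfl, rfl⟩ rfl rfl rfl rfl
      (show (splitItem (splitItem (splitItem (splitItem rule).2).2).2).1.length < N by omega) hn)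
    (Does.seq (does_forItems_testPos _ I _ ⟨rfl, rfl, rfl, rfl, rfl, rfl⟩ rfl rfl rfl
      (show (splitItem (splitItem (splitItem rule).2).2).1.length < N by omega) hIN)
    (Does.seq (does_copy .D .lst _ (by decide) (by decide) (by decide) rfl (by exact hDN))
    (Does.seq (does_copy .I .J _ (by decide) (by decide) (by decide) rfl (by exact hIN))
    (Does.seq (does_distribute (N := N) _ (encWords D) cert I [] rfl rfl
      (by exact List.append_nil _) rfl (by exact List.append_nil _) rfl hDN)
    (Does.seq (does_clear_get (N := N) .rest _ ?_)
    (Does.seq (does_forItems_testAgg (N := N) _ (D.foldl chooseList (cert, I, [])).2.1 _ rfl rfl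
      rfl rfl (by simp only [Stacks.set, decWords_encWords]) rfl
      (show (splitItem (splitItem rule).2).1.length < N by omega) ?_)
    (Does.seq (does_clear_get (N := N) .J _ ?_)
    (does_ifFlag (n := 2) _ (ruleOK A D I (D.foldl chooseList (cert, I, [])).2.1 rule) ?_ ?_))))))))))))))) ?_
  · simp only [Stacks.get, decWords_encWords]
    omega
  · omega
  · simp only [Stacks.get, Stacks.set, decWords_encWords]
    omega
  · simp only [Stacks.get, Stacks.set, ruleOK, Bool.false_or]
    congr!
  · simp only [Stacks.set, decWords_encWords]
    generalize ruleOK A D I (D.foldl chooseList (cert, I, [])).2.1 rule = c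
    cases c
    · refine (does_setFlag .bad (c := bad) _ rfl).congr ?_ le_rfl
      simp [Stacks.set]
    · refine (Does.skip _).congr ?_ (by simp)
      simp
  · have h0 := le_sq_and_one_le_of_lt hn
    have h0' : N ^ 2 ≤ N ^ 3 := Nat.pow_le_pow_right h0.2 (by norm_num)
    omega

end StackProg

namespace StackProg

variable {A : Language Bool} {N : ℕ}

/-- The verdict of the verifier, as contents of the stack `found`: all rules have been found to be
in order and `D` is not empty, or some rule has not and `D` is empty. -/
def giveVerdict : StackProg Reg :=
  ifFlag .bad
    (pop .D fun o => match o with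
      | none => push .found true
      | some _ => skip)
    (pop .D fun o => match o with
      | none => skip
      | some _ => push .found true)

/-- The verifier: split the atoms of the interpretation into `D` and `I` as the certificate says,
then check all rules. -/
def verifier : StackProg Reg :=
  next .inp .inst ;; next .inp .cert ;; next .inst .rules ;; next .inst .lst ;; distribute ;;
  copy .J .D ;; clear .J ;; copy .rest .I ;; clear .rest ;;
  forItems .rules .rule checkRule ;; giveVerdict

/-- The effect of the check of one rule on the certificate and the flag `bad`. -/
noncomputable def ruleStep (A : Language Bool) (D I : List (List Bool)) (q : List Bool × Bool)
    (v : List Bool) : List Bool × Bool :=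
  ((D.foldl chooseList (q.1, I, [])).1,
    q.2 || !ruleOK A D I (D.foldl chooseList (q.1, I, [])).2.1 v)

/-- The verifier accepts the sequences `R` of rules and `M` of atoms with the certificate `y`. -/
def Accepts (A : Language Bool) (R M : List (List Bool)) (y : List Bool) : Prop :=
  let i := M.foldl chooseList (y, [], [])
  (R.foldl (ruleStep A i.2.1 i.2.2) (i.1, false)).2 = false ↔ i.2.1 ≠ []

/-- The language of the verifier. -/
def verifierLanguage (A : Language Bool) : Language Bool :=
  {v | Accepts A (decWords (splitItem (splitItem v).1).1)
    (decWords (splitItem (splitItem (splitItem v).1).2).1) (splitItem (splitItem v).2).1}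

theorem does_giveVerdict (r : Stacks) (D : List (List Bool)) (bad : Bool) (h1 : r.found = [])
    (hD : r.D = encWords D) (hbad : r.bad = flag bad) :
    ∃ s, Does A giveVerdict r.get 3 s ∧ (s .found ≠ [] ↔ (bad = false ↔ D ≠ [])) := by
  have hD' : D = [] ↔ encWords D = [] := by
    rw [← encWords_nil, encWords_injective.eq_iff]
  suffices h : ∃ s, Does A (if bad then (pop .D fun o => match o with
      | none => push .found true
      | some _ => skip) else (pop .D fun o => match o with
      | none => skip
      | some _ => push .found true)) (r.set .bad []).get 2 s ∧
      (s .found ≠ [] ↔ (bad = false ↔ D ≠ [])) from by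
    obtain ⟨s, hs, h⟩ := h
    exact ⟨s, does_ifFlag r bad hbad hs, h⟩
  have hget : (r.set .bad []).get .D = encWords D := hD
  rw [ne_eq D, hD']
  cases bad <;> rcases h : encWords D with _ | ⟨b, w⟩
  · refine ⟨((r.set .bad []).set .D []).get, Does.pop (n := 1) ?_, ?_⟩
    · rw [hget, h, Stacks.update_get]
      exact (Does.skip _).mono (by simp)
    · simp [Stacks.get, Stacks.set, h1]
  · refine ⟨(((r.set .bad []).set .D w).set .found [true]).get, Does.pop (n := 1) ?_, ?_⟩
    · rw [hget, h, Stacks.update_get]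
      refine (Does.push _ _ _).congr ?_ le_rfl
      rw [Stacks.update_get]
      simp [Stacks.get, Stacks.set, h1]
    · simp [Stacks.get, Stacks.set]
  · refine ⟨(((r.set .bad []).set .D []).set .found [true]).get, Does.pop (n := 1) ?_, ?_⟩
    · rw [hget, h, Stacks.update_get]
      refine (Does.push _ _ _).congr ?_ le_rfl
      rw [Stacks.update_get]
      simp [Stacks.get, Stacks.set, h1]
    · simp [Stacks.get, Stacks.set]
  · refine ⟨((r.set .bad []).set .D w).get, Does.pop (n := 1) ?_, ?_⟩
    · rw [hget, h, Stacks.update_get]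
      exact (Does.skip _).mono (by simp)
    · simp [Stacks.get, Stacks.set, h1]

theorem does_forItems_checkRule (r : Stacks) (D I : List (List Bool)) (bad : Bool) (hr : r.Clean)
    (hx : r.x = []) (hagg : r.agg = []) (hpos : r.pos = []) (hneg : r.neg = []) (hJ : r.J = [])
    (hJ2 : r.J2 = []) (hqry : r.qry = []) (hrest : r.rest = []) (hok : r.ok = [])
    (hD : r.D = encWords D) (hI : r.I = encWords I) (hbad : r.bad = flag bad)
    (hrule : r.rule = []) (hw : r.rules.length < N) (hn : (encWords (I ++ D)).length < N) :
    Does A (forItems .rules .rule checkRule) r.get (257 * N ^ 4) { r with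
      rules := []
      cert := ((decWords r.rules).foldl (ruleStep A D I) (r.cert, bad)).1
      bad := flag ((decWords r.rules).foldl (ruleStep A D I) (r.cert, bad)).2 }.get := by
  have := does_forItems (A := A) (a := .rules) (b := .rule) (body := checkRule) (N := N)
    (fun w (q : List Bool × Bool) => { r with rules := w, cert := q.1, bad := flag q.2 })
    (ruleStep A D I) (T := 250 * N ^ 3) (by decide) (by decide) (by decide) (fun _ _ => rfl)
    (fun _ _ _ => rfl) (fun _ _ => hrule) (fun _ _ => hr.tmp)
    (fun w q v hv => (does_checkRule
      (Stacks.set { r with rules := w, cert := q.1, bad := flag q.2 } .rule v) D I q.2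
      ⟨hr.tmp, hr.x2, hr.mis, hr.found, hr.z, hr.lst⟩ hx hagg hpos hneg hJ hJ2 hqry hrest hok
      hD hI rfl hv hn).conv rfl
      (by cases r; simp_all [Stacks.set, ruleStep]) le_rfl)
    r.rules (r.cert, bad) hw
  refine this.conv (by cases r; simp_all) rfl ?_
  have h0 := le_sq_and_one_le_of_lt hn
  have h1 : N ^ 2 ≤ N ^ 4 := Nat.pow_le_pow_right h0.2 (by norm_num)
  nlinarith

theorem does_verifier (v : List Bool) :
    ∃ s, Does A verifier (Stacks.get { inp := v }) (400 * (v.length + 2) ^ 4) s ∧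
      (s .found ≠ [] ↔ v ∈ verifierLanguage A) := by
  obtain ⟨N, hN⟩ : ∃ N, N = v.length + 2 := ⟨_, rfl⟩
  rw [← hN]
  have l0 := length_splitItem v
  have l1 := length_splitItem (splitItem v).2
  have l2 := length_splitItem (splitItem v).1
  have l3 := length_splitItem (splitItem (splitItem v).1).2
  have lm := length_encWords_decWords (splitItem (splitItem (splitItem v).1).2).1
  have lc := length_encWords_chooseList (decWords (splitItem (splitItem (splitItem v).1).2).1)
    ((splitItem (splitItem v).2).1, [], [])
  obtain ⟨i, hi⟩ : ∃ i, i = (decWords (splitItem (splitItem (splitItem v).1).2).1).foldl chooseList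
    ((splitItem (splitItem v).2).1, [], []) := ⟨_, rfl⟩
  rw [← hi] at lc
  simp only [encWords_nil, List.length_nil] at lc
  obtain ⟨s, hs, hacc⟩ := does_giveVerdict (A := A) {
      inp := (splitItem (splitItem v).2).2
      inst := (splitItem (splitItem (splitItem v).1).2).2
      D := encWords i.2.1
      I := encWords i.2.2
      cert := ((decWords (splitItem (splitItem v).1).1).foldl (ruleStep A i.2.1 i.2.2)
        (i.1, false)).1
      bad := flag ((decWords (splitItem (splitItem v).1).1).foldl (ruleStep A i.2.1 i.2.2)
        (i.1, false)).2 } i.2.1 _ rfl rfl rfl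
  refine ⟨s, ?_, hacc.trans ?_⟩
  · refine Does.mono
      (Does.seq (does_next .inp .inst (N := N) _ (by decide) (by decide) (by decide) rfl rfl
        (show v.length < N by omega))
      (Does.seq (does_next .inp .cert (N := N) _ (by decide) (by decide) (by decide) rfl rfl
        (show (splitItem v).2.length < N by omega))
      (Does.seq (does_next .inst .rules (N := N) _ (by decide) (by decide) (by decide) rfl rfl
        (show (splitItem v).1.length < N by omega))
      (Does.seq (does_next .inst .lst (N := N) _ (by decide) (by decide) (by decide) rfl rfl
        (show (splitItem (splitItem v).1).2.length < N by omega))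
      (Does.seq (does_distribute (N := N) _ _ _ [] [] rfl rfl rfl rfl rfl rfl
        (show (splitItem (splitItem (splitItem v).1).2).1.length < N by omega))
      (Does.seq (does_copy .J .D (N := N) _ (by decide) (by decide) (by decide) rfl ?_)
      (Does.seq (does_clear_get .J (N := N) _ ?_)
      (Does.seq (does_copy .rest .I (N := N) _ (by decide) (by decide) (by decide) rfl ?_)
      (Does.seq (does_clear_get .rest (N := N) _ ?_)
      (Does.seq (m := 3) (does_forItems_checkRule (N := N) _ i.2.1 i.2.2 false
        ⟨rfl, rfl, rfl, rfl, rfl, rfl⟩ rfl rfl rfl rfl rfl rfl rfl rfl rfl ?_ ?_ rfl rfl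
        (show (splitItem (splitItem v).1).1.length < N by omega) ?_) ?_)))))))))) ?_
    · simp only [Stacks.get, Stacks.set, ← hi]; omega
    · simp only [Stacks.get, Stacks.set, ← hi]; omega
    · simp only [Stacks.get, Stacks.set, ← hi]; omega
    · simp only [Stacks.get, Stacks.set, ← hi]; omega
    · simp [Stacks.get, Stacks.set, ← hi]
    · simp [Stacks.get, Stacks.set, ← hi]
    · rw [encWords_append, List.length_append]; omega
    · simpa [Stacks.get, Stacks.set, ← hi] using hs
    · have h0 := le_sq_and_one_le_of_lt (show v.length < N by omega)
      have h1 : N ^ 2 ≤ N ^ 4 := Nat.pow_le_pow_right h0.2 (by norm_num)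
      omega
  · subst hi
    exact Iff.rfl

theorem verifierLanguage_mem_PRel (A : Language Bool) : verifierLanguage A ∈ PRel A := by
  refine mem_PRel verifier .inp .found (Polynomial.C 400 * (Polynomial.X + 2) ^ 4) fun w => ?_
  obtain ⟨s, ⟨t, ht, hr⟩, hs⟩ := does_verifier (A := A) w
  refine ⟨t, ?_, s, ?_, hs⟩
  · simpa using ht
  · convert hr using 1
    funext k
    cases k <;> rfl

end StackProg

namespace AspSignature

variable {S : AspSignature}

/-! ## Fixpoint answer sets -/

open Classical in
theorem AggAtom.sat_congr {σ : S.ProgSig} {ℓ : S.AggAtom} {I J : Set S.Atom}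
    (h : ∀ a, a.pred = ℓ.source.pred → (a ∈ I ↔ a ∈ J)) : ℓ.Sat σ I ↔ ℓ.Sat σ J := by
  have : ℓ.source.value σ I = ℓ.source.value σ J := by
    rcases ℓ with ⟨g, p | ⟨r, p⟩, o, v⟩
    · exact congrArg Sum.inl (Finset.filter_congr fun a _ => h (p.inst fun _ => a) rfl)
    · exact congrArg (fun t : Finset _ => Sum.inr (t.val.map fun γ => γ 0))
        (Finset.filter_congr fun γ _ => h (p.inst γ) rfl)
  rw [AggAtom.Sat, this, AggAtom.Sat]

theorem AggAtom.condSat_iff {σ : S.ProgSig} {ℓ : S.AggAtom} {I M : Set S.Atom} (hM : M ⊆ σ.base)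
    (hI : I ⊆ M) : ℓ.CondSat σ I M ↔ ∀ J, I ⊆ J → J ⊆ M → ℓ.Sat σ J := by
  constructor
  · rintro ⟨-, -, -, h⟩ J hIJ hJM
    refine h J (hJM.trans hM) (fun a ha => hIJ ha.1.1) ?_
    ext a
    simp only [Set.mem_inter_iff, Set.mem_sdiff, Set.mem_empty_iff_false, iff_false]
    exact fun ha => ha.1.2 (hJM ha.2)
  · intro h
    refine ⟨Set.inter_subset_right, Set.sdiff_subset, ?_, fun J hJ h₁ h₂ => ?_⟩
    · rw [Set.disjoint_left]
      exact fun a ha ha' => ha'.2 ha.1.2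
    · have hext : ∀ a, a.pred = ℓ.source.pred → (a ∈ (J ∩ ℓ.ext σ) ∪ I ↔ a ∈ J) := by
        intro a ha
        constructor
        · rintro (h | h)
          · exact h.1
          · exact h₁ ⟨⟨h, hI h⟩, hM (hI h), ha⟩
        · exact fun h => .inl ⟨h, hJ h, ha⟩
      rw [← AggAtom.sat_congr hext]
      refine h _ Set.subset_union_right (Set.union_subset (fun a ha => ?_) hI)
      by_contra haM
      have : a ∈ ℓ.ext σ \ M ∩ J := ⟨⟨ha.2, haM⟩, ha.1⟩
      rw [h₂] at this
      exact this

theorem AggAtom.CondSat.mono {σ : S.ProgSig} {ℓ : S.AggAtom} {I I' M : Set S.Atom}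
    (h : ℓ.CondSat σ I M) (hI : I ⊆ I') : ℓ.CondSat σ I' M := by
  refine ⟨Set.inter_subset_right, Set.sdiff_subset, ?_, fun J hJ h₁ h₂ => ?_⟩
  · rw [Set.disjoint_left]
    exact fun a ha ha' => ha'.2 ha.1.2
  · exact h.2.2.2 J hJ (fun a ha => h₁ ⟨⟨hI ha.1.1, ha.1.2⟩, ha.2⟩) h₂

namespace Program

theorem K_mono (P : S.Program) (M : Set S.Atom) : Monotone (P.K M) := by
  rintro I I' hI a ⟨r, hr, hpos, hagg, rfl⟩
  exact ⟨r, hr, fun b hb => hI (hpos b hb), fun ℓ hℓ => (hagg ℓ hℓ).mono hI, rfl⟩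

theorem K_subset_base (P : S.Program) (M I : Set S.Atom) : P.K M I ⊆ P.sig.base := by
  rintro a ⟨r', ⟨r, hr, -, rfl⟩, -, -, rfl⟩
  exact (P.rules_over r hr).1

theorem isFixpointAnswerSet_iff (P : S.Program) {M : Set S.Atom} (hM : M ⊆ P.sig.base) :
    P.IsFixpointAnswerSet M ↔ P.K M M ⊆ M ∧ ∀ I ⊆ M, P.K M I ⊆ I → I = M := by
  let f : Set S.Atom →o Set S.Atom := ⟨P.K M, P.K_mono M⟩
  have hfix : P.K M f.lfp = f.lfp := f.map_lfp
  constructor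
  · rintro ⟨⟨-, hKM⟩, hleast⟩
    refine ⟨hKM.le, fun I hI hK => hI.antisymm ?_⟩
    exact (hleast ⟨hfix ▸ P.K_subset_base M _, hfix⟩).trans (f.lfp_le hK)
  · rintro ⟨hKM, hmin⟩
    have hlfp : f.lfp = M := hmin _ (f.lfp_le hKM) hfix.le
    refine ⟨⟨hM, by rwa [hlfp] at hfix⟩, fun I hI => ?_⟩
    rw [← hlfp]
    exact f.lfp_le hI.2.le

end Program

/-- With respect to `M`, the rule `r` does not derive an atom outside `I`. -/
def Rule.Respects (σ : S.ProgSig) (M I : Set S.Atom) (r : S.Rule) : Prop :=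
  r.head ∈ I ∨ (∃ b ∈ r.neg, b ∈ M) ∨ (∃ b ∈ r.pos, b ∉ I) ∨
    ∃ ℓ ∈ r.agg, ∃ J, I ⊆ J ∧ J ⊆ M ∧ ¬ ℓ.Sat σ J

theorem Program.K_subset_iff (P : S.Program) {M I : Set S.Atom} (hM : M ⊆ P.sig.base)
    (hI : I ⊆ M) : P.K M I ⊆ I ↔ ∀ r ∈ P.rules, r.Respects P.sig M I := by
  constructor
  · intro h r hr
    by_contra hc
    simp only [Rule.Respects, not_or, not_exists, not_and, not_not] at hc
    obtain ⟨h1, h2, h3, h4⟩ := hc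
    exact h1 (h ⟨_, ⟨r, hr, h2, rfl⟩, h3,
      fun ℓ hℓ => (AggAtom.condSat_iff hM hI).2 (h4 ℓ hℓ), rfl⟩)
  · rintro h a ⟨r', ⟨r, hr, hneg, rfl⟩, hpos, hagg, rfl⟩
    rcases h r hr with h | ⟨b, hb, h⟩ | ⟨b, hb, h⟩ | ⟨ℓ, hℓ, J, h₁, h₂, h₃⟩
    · exact h
    · exact absurd h (hneg b hb)
    · exact absurd (hpos b hb) h
    · exact absurd ((AggAtom.condSat_iff hM hI).1 (hagg ℓ hℓ) J h₁ h₂) h₃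

theorem Program.not_isFixpointAnswerSet_iff (P : S.Program) {M : Set S.Atom}
    (hM : M ⊆ P.sig.base) : ¬ P.IsFixpointAnswerSet M ↔
      (∃ r ∈ P.rules, ¬ r.Respects P.sig M M) ∨
        ∃ I ⊆ M, I ≠ M ∧ ∀ r ∈ P.rules, r.Respects P.sig M I := by
  rw [P.isFixpointAnswerSet_iff hM, not_and_or, P.K_subset_iff hM subset_rfl]
  refine or_congr (by push Not; rfl) ?_
  constructor
  · intro h
    push Not at h
    obtain ⟨I, hI, hK, hne⟩ := h
    exact ⟨I, hI, hne, (P.K_subset_iff hM hI).1 hK⟩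
  · rintro ⟨I, hI, hne, hK⟩ h
    exact hne (h I hI ((P.K_subset_iff hM hI).2 hK))

theorem Atom.enc_injective : Function.Injective (Atom.enc (S := S)) := by
  rintro ⟨p, c⟩ ⟨p', c'⟩ h
  have h1 := encWords_injective h
  simp only [List.cons.injEq] at h1
  obtain ⟨h1, h2⟩ := h1
  obtain rfl := S.predName_injective h1
  congr
  funext i
  exact S.constName_injective (congrFun (List.ofFn_injective h2) i)

end AspSignature

namespace StackProg

/-! ## Certificates -/

theorem foldl_chooseList_perm (l : List (List Bool))
    (i : List Bool × List (List Bool) × List (List Bool)) :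
    ((l.foldl chooseList i).2.1 ++ (l.foldl chooseList i).2.2).Perm (l ++ (i.2.1 ++ i.2.2)) := by
  induction l generalizing i with
  | nil => simp
  | cons v l ih =>
    refine (ih _).trans ?_
    rw [chooseList]
    split
    · simp
    · refine List.Perm.trans ?_ (List.perm_middle (a := v) (l₁ := l) (l₂ := i.2.1 ++ i.2.2))
      exact List.Perm.append_left _ List.perm_middle

theorem subset_foldl_chooseList (l : List (List Bool))
    (i : List Bool × List (List Bool) × List (List Bool)) :
    i.2.1 ⊆ (l.foldl chooseList i).2.1 := by
  induction l generalizing i with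
  | nil => simp
  | cons v l ih =>
    refine List.Subset.trans ?_ (ih _)
    rw [chooseList]
    split <;> simp

theorem foldl_chooseList_map (p : List Bool → Bool) (l : List (List Bool)) (y : List Bool)
    (a b : List (List Bool)) :
    l.foldl chooseList (l.map p ++ y, a, b) =
      (y, (l.filter p).reverse ++ a, (l.filter fun v => !p v).reverse ++ b) := by
  induction l generalizing a b with
  | nil => rfl
  | cons v l ih =>
    cases h : p v <;> simp [chooseList, h, ih]

variable {A : Language Bool} {D I : List (List Bool)}

theorem foldl_ruleStep_of_bad (R : List (List Bool)) (y : List Bool) :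
    (R.foldl (ruleStep A D I) (y, true)).2 = true := by
  induction R generalizing y with
  | nil => rfl
  | cons v R ih => simp [ruleStep, ih]

theorem ruleOK_of_foldl_ruleStep {R : List (List Bool)} {y : List Bool}
    (h : (R.foldl (ruleStep A D I) (y, false)).2 = false) :
    ∀ v ∈ R, ∃ y', ruleOK A D I (D.foldl chooseList (y', I, [])).2.1 v = true := by
  induction R generalizing y with
  | nil => simp
  | cons v R ih =>
    rw [List.foldl_cons, ruleStep] at h
    cases hv : ruleOK A D I (D.foldl chooseList (y, I, [])).2.1 v
    · simp [hv, foldl_ruleStep_of_bad] at h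
    · simp only [hv, Bool.not_true, Bool.or_false] at h
      simp only [List.mem_cons, forall_eq_or_imp]
      exact ⟨⟨y, hv⟩, ih h⟩

theorem exists_foldl_ruleStep {R : List (List Bool)}
    (h : ∀ v ∈ R, ∃ p : List Bool → Bool, ruleOK A D I ((D.filter p).reverse ++ I) v = true) :
    ∃ y : List Bool, y.length = R.length * D.length ∧
      (R.foldl (ruleStep A D I) (y, false)).2 = false := by
  induction R with
  | nil => exact ⟨[], by simp, rfl⟩
  | cons v R ih =>
    simp only [List.mem_cons, forall_eq_or_imp] at h
    obtain ⟨⟨p, hp⟩, h⟩ := h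
    obtain ⟨y, hy, hy'⟩ := ih h
    refine ⟨D.map p ++ y, by simp [hy, Nat.succ_mul, add_comm], ?_⟩
    simpa [ruleStep, foldl_chooseList_map, hp] using hy'

theorem ruleOK_encWords {J : List (List Bool)} (g p n : List (List Bool)) (w : List Bool) :
    ruleOK A D I J (encWords [w, encWords g, encWords p, encWords n]) = true ↔
      w ∈ I ∨ (∃ u ∈ n, u ∈ I ++ D) ∨ (∃ u ∈ p, u ∉ I) ∨
        ∃ u ∈ g, encWords [u, encWords J] ∉ A := by
  simp [ruleOK, encWords_cons, splitItem_encItem_append, decWords_encWords, or_assoc]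

end StackProg

namespace AspSignature

variable {S : AspSignature}

open StackProg

theorem mem_map_enc {a : S.Atom} {l : List S.Atom} : a.enc ∈ l.map Atom.enc ↔ a ∈ l :=
  List.mem_map_of_injective Atom.enc_injective

theorem exists_eq_map_enc {l : List S.Atom} {J : List (List Bool)} (h : J ⊆ l.map Atom.enc) :
    ∃ j : List S.Atom, J = j.map Atom.enc := by
  have : J ∈ Set.range (List.map (Atom.enc (S := S))) := by
    rw [Set.range_list_map]
    intro v hv
    obtain ⟨a, -, rfl⟩ := List.mem_map.1 (h hv)
    exact ⟨a, rfl⟩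
  obtain ⟨j, rfl⟩ := this
  exact ⟨j, rfl⟩

theorem ruleOK_enc_iff {A : Language Bool} {d i j : List S.Atom} {r : S.Rule} :
    ruleOK A (d.map Atom.enc) (i.map Atom.enc) (j.map Atom.enc) r.enc = true ↔
      r.head ∈ i ∨ (∃ b ∈ r.neg, b ∈ i ∨ b ∈ d) ∨ (∃ b ∈ r.pos, b ∉ i) ∨
        ∃ ℓ ∈ r.agg, encWords [ℓ.enc, encAtoms j] ∉ A := by
  rw [Rule.enc, encAtoms, encAtoms, ruleOK_encWords, ← List.map_append]
  have h : ∀ {α : Type} (f : α → List Bool) (k : List α) (p : List Bool → Prop),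
      (∃ u ∈ k.map f, p u) ↔ ∃ a ∈ k, p (f a) := by simp
  simp only [h, mem_map_enc, List.mem_append]
  rfl

/-- The oracle `A` decides the aggregate atoms in `𝒜`. -/
def Decides (A : Language Bool) (𝒜 : Set S.AggAtom) : Prop :=
  ∀ (σ : S.ProgSig) (ℓ : S.AggAtom), ℓ ∈ 𝒜 → ℓ.Over σ →
    ∀ (l : List S.Atom) (M : Set S.Atom), Lists σ l M →
      (encWords [ℓ.enc, encAtoms l] ∈ A ↔ ℓ.Sat σ M)

theorem not_isFixpointAnswerSet_of_accepts {A : Language Bool} {𝒜 : Set S.AggAtom}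
    (hA : Decides A 𝒜) {P : S.Program} (hP : P.AggregatesIn 𝒜) {l : List S.Atom}
    {M : Set S.Atom} (hl : Lists P.sig l M) {y : List Bool}
    (h : Accepts A (P.rules.map Rule.enc) (l.map Atom.enc) y) : ¬ P.IsFixpointAnswerSet M := by
  rw [P.not_isFixpointAnswerSet_iff hl.1]
  have hperm := foldl_chooseList_perm (l.map Atom.enc) (y, [], [])
  unfold Accepts at h
  generalize (l.map Atom.enc).foldl chooseList (y, [], []) = t at h hperm
  obtain ⟨y', D, I⟩ := t
  simp only [List.append_nil] at h hperm
  obtain ⟨d, rfl⟩ := exists_eq_map_enc fun v hv => hperm.subset (List.mem_append_left _ hv)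
  obtain ⟨i, rfl⟩ := exists_eq_map_enc fun v hv => hperm.subset (List.mem_append_right _ hv)
  rw [← List.map_append] at hperm
  replace hperm : (d ++ i).Perm l := (List.map_perm_map_iff Atom.enc_injective).1 hperm
  have hmem : ∀ a, a ∈ M ↔ a ∈ d ∨ a ∈ i := fun a => by
    rw [← hl.2.2 a, ← hperm.mem_iff, List.mem_append]
  have hnodup : (d ++ i).Nodup := hperm.nodup_iff.2 hl.2.1
  rcases d with _ | ⟨a, d⟩
  · left
    by_contra hc
    push Not at hc
    refine absurd (h.1 ?_) (by simp)
    suffices h' : ∀ R : List S.Rule, R ⊆ P.rules →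
        ((R.map Rule.enc).foldl (ruleStep A [] (i.map Atom.enc)) (y', false)).2 = false from
      h' P.rules (List.Subset.refl _)
    intro R
    induction R with
    | nil => intro _; rfl
    | cons r R ih =>
      intro hR
      rw [List.cons_subset] at hR
      have hok : ruleOK A [] (i.map Atom.enc) (i.map Atom.enc) r.enc = true := by
        refine (ruleOK_enc_iff (d := [])).2 ?_
        simp only [List.not_mem_nil, false_or] at hmem
        simp only [List.not_mem_nil, or_false, ← hmem]
        rcases hc r hR.1 with h | h | h | ⟨ℓ, hℓ, J, h₁, h₂, h₃⟩
        · exact .inl h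
        · exact .inr (.inl h)
        · exact .inr (.inr (.inl h))
        · refine .inr (.inr (.inr ⟨ℓ, hℓ, ?_⟩))
          obtain rfl : J = M := h₂.antisymm h₁
          rwa [hA P.sig ℓ (hP r hR.1 ℓ hℓ) ((P.rules_over r hR.1).2.2.2 ℓ hℓ) i J
            ⟨hl.1, by simpa using hnodup, fun a => (hmem a).symm⟩]
      simpa [ruleStep, hok] using ih hR.2
  · right
    have hbad := h.2 (by simp)
    refine ⟨{b | b ∈ i}, fun b hb => (hmem b).2 (.inr hb), ?_, fun r hr => ?_⟩
    · intro he
      have ha : a ∈ M := (hmem a).2 (by simp)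
      rw [← he] at ha
      exact (List.nodup_append.1 hnodup).2.2 a (by simp) a ha rfl
    · obtain ⟨z, hz⟩ := ruleOK_of_foldl_ruleStep hbad r.enc (List.mem_map_of_mem hr)
      have hp := foldl_chooseList_perm ((a :: d).map Atom.enc) (z, i.map Atom.enc, [])
      have hs := subset_foldl_chooseList ((a :: d).map Atom.enc) (z, i.map Atom.enc, [])
      generalize ((a :: d).map Atom.enc).foldl chooseList (z, i.map Atom.enc, []) = t at hz hp hs
      obtain ⟨z', J, J'⟩ := t
      simp only [List.append_nil] at hp hz hs
      rw [← List.map_append] at hp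
      obtain ⟨j, rfl⟩ := exists_eq_map_enc fun v hv => hp.subset (List.mem_append_left _ hv)
      obtain ⟨j', rfl⟩ := exists_eq_map_enc fun v hv => hp.subset (List.mem_append_right _ hv)
      rw [← List.map_append] at hp
      replace hp := (List.map_perm_map_iff Atom.enc_injective).1 hp
      have hjM : ∀ b ∈ j, b ∈ M := fun b hb => by
        rw [hmem, ← List.mem_append]
        exact hp.subset (List.mem_append_left _ hb)
      rcases ruleOK_enc_iff.1 hz with h | ⟨b, hb, h⟩ | h | ⟨ℓ, hℓ, h⟩
      · exact .inl h
      · exact .inr (.inl ⟨b, hb, (hmem b).2 h.symm⟩)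
      · exact .inr (.inr (.inl h))
      · refine .inr (.inr (.inr ⟨ℓ, hℓ, {b | b ∈ j}, ?_, hjM, ?_⟩))
        · intro b hb
          exact mem_map_enc.1 (hs (mem_map_enc.2 hb))
        · rwa [← hA P.sig ℓ (hP r hr ℓ hℓ) ((P.rules_over r hr).2.2.2 ℓ hℓ) j {b | b ∈ j}
            ⟨fun b hb => hl.1 (hjM b hb), (List.nodup_append.1 (hp.nodup_iff.2 hnodup)).1,
              fun b => Iff.rfl⟩]

open Classical in
/-- The words of the atoms that satisfy `p`. -/
noncomputable def encPred (p : S.Atom → Prop) (v : List Bool) : Bool :=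
  decide (∃ a : S.Atom, a.enc = v ∧ p a)

theorem encPred_enc {p : S.Atom → Prop} (a : S.Atom) : encPred p a.enc = true ↔ p a := by
  simp [encPred, Atom.enc_injective.eq_iff]

open Classical in
theorem filter_encPred (p : S.Atom → Prop) (l : List S.Atom) :
    (l.map Atom.enc).filter (encPred p) = (l.filter p).map Atom.enc := by
  rw [List.filter_map]
  congr 2
  funext a
  rw [Bool.eq_iff_iff]
  simp [encPred_enc]

open Classical in
theorem filter_not_encPred (p : S.Atom → Prop) (l : List S.Atom) :
    (l.map Atom.enc).filter (fun v => !encPred p v) = (l.filter (¬ p ·)).map Atom.enc := by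
  rw [List.filter_map]
  congr 2
  funext a
  rw [Bool.eq_iff_iff]
  simp [← encPred_enc]

open Classical in
theorem exists_accepts {A : Language Bool} {𝒜 : Set S.AggAtom}
    (hA : Decides A 𝒜) {P : S.Program} (hP : P.AggregatesIn 𝒜) {l : List S.Atom}
    {M : Set S.Atom} (hl : Lists P.sig l M) (h : ¬ P.IsFixpointAnswerSet M) :
    ∃ y : List Bool, y.length ≤ l.length + P.rules.length * l.length ∧
      Accepts A (P.rules.map Rule.enc) (l.map Atom.enc) y := by
  rw [P.not_isFixpointAnswerSet_iff hl.1] at h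
  rcases h with ⟨r, hr, h⟩ | ⟨I, hI, hne, h⟩
  · refine ⟨(l.map Atom.enc).map fun _ => false, by simp, ?_⟩
    have he := foldl_chooseList_map (fun _ => false) (l.map (Atom.enc (S := S))) [] [] []
    rw [List.append_nil] at he
    simp only [Accepts, he]
    simp only [List.filter_false, List.reverse_nil, List.append_nil, Bool.not_false,
      List.filter_true, ne_eq, not_true_eq_false, iff_false]
    intro hbad
    obtain ⟨z, hz⟩ := ruleOK_of_foldl_ruleStep hbad r.enc (List.mem_map_of_mem hr)
    refine h ?_
    rw [← List.map_reverse] at hz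
    have hmem : ∀ a, a ∈ M ↔ a ∈ l.reverse := fun a => by rw [List.mem_reverse, hl.2.2 a]
    rcases (ruleOK_enc_iff (d := [])).1 hz with h | ⟨b, hb, h⟩ | ⟨b, hb, h⟩ | ⟨ℓ, hℓ, h⟩
    · exact .inl ((hmem _).2 h)
    · exact .inr (.inl ⟨b, hb, (hmem b).2 (by simpa using h)⟩)
    · exact .inr (.inr (.inl ⟨b, hb, fun hb' => h ((hmem b).1 hb')⟩))
    · refine .inr (.inr (.inr ⟨ℓ, hℓ, M, subset_rfl, subset_rfl, ?_⟩))
      rwa [← hA P.sig ℓ (hP r hr ℓ hℓ) ((P.rules_over r hr).2.2.2 ℓ hℓ) l.reverse M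
        ⟨hl.1, List.nodup_reverse.2 hl.2.1, fun a => (hmem a).symm⟩]
  · obtain ⟨d, hd⟩ : ∃ d, d = (l.filter (· ∉ I)).reverse := ⟨_, rfl⟩
    obtain ⟨i, hi⟩ : ∃ i, i = (l.filter (· ∈ I)).reverse := ⟨_, rfl⟩
    have hmd : ∀ a, a ∈ d ↔ a ∈ M ∧ a ∉ I := fun a => by simp [hd, hl.2.2]
    have hmi : ∀ a, a ∈ i ↔ a ∈ I := fun a => by
      simp only [hi, List.mem_reverse, List.mem_filter, hl.2.2, decide_eq_true_eq]
      exact ⟨fun h => h.2, fun h => ⟨hI h, h⟩⟩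
    have hdn : d.Nodup := hd ▸ List.nodup_reverse.2 (hl.2.1.filter _)
    have hin : i.Nodup := hi ▸ List.nodup_reverse.2 (hl.2.1.filter _)
    have hrules : ∀ v ∈ P.rules.map Rule.enc, ∃ p : List Bool → Bool,
        ruleOK A (d.map Atom.enc) (i.map Atom.enc)
          (((d.map Atom.enc).filter p).reverse ++ i.map Atom.enc) v = true := by
      intro v hv
      obtain ⟨r, hr, rfl⟩ := List.mem_map.1 hv
      suffices hs : ∃ J : Set S.Atom, r.head ∈ i ∨ (∃ b ∈ r.neg, b ∈ i ∨ b ∈ d) ∨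
          (∃ b ∈ r.pos, b ∉ i) ∨
          ∃ ℓ ∈ r.agg, encWords [ℓ.enc, encAtoms ((d.filter (· ∈ J)).reverse ++ i)] ∉ A by
        obtain ⟨J, hJ⟩ := hs
        refine ⟨encPred (· ∈ J), ?_⟩
        rw [filter_encPred, ← List.map_reverse, ← List.map_append, ruleOK_enc_iff]
        exact hJ
      simp only [hmi, hmd]
      rcases h r hr with h | ⟨b, hb, h⟩ | h | ⟨ℓ, hℓ, J, h₁, h₂, h₃⟩
      · exact ⟨∅, .inl h⟩
      · exact ⟨∅, .inr (.inl ⟨b, hb, (Classical.em (b ∈ I)).imp_right fun hb' => ⟨h, hb'⟩⟩)⟩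
      · exact ⟨∅, .inr (.inr (.inl h))⟩
      · refine ⟨J, .inr (.inr (.inr ⟨ℓ, hℓ, ?_⟩))⟩
        rwa [hA P.sig ℓ (hP r hr ℓ hℓ) ((P.rules_over r hr).2.2.2 ℓ hℓ) _ J]
        refine ⟨h₂.trans hl.1, List.nodup_append.2 ⟨List.nodup_reverse.2 (hdn.filter _), hin, ?_⟩,
          fun a => ?_⟩
        · rintro a ha b hb rfl
          simp only [List.mem_reverse, List.mem_filter, hmd] at ha
          exact ha.1.2 ((hmi a).1 hb)
        · simp only [List.mem_append, List.mem_reverse, List.mem_filter, hmd, hmi,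
            decide_eq_true_eq]
          constructor
          · rintro (h | h)
            · exact h.2
            · exact h₁ h
          · intro ha
            by_cases haI : a ∈ I
            · exact .inr haI
            · exact .inl ⟨⟨h₂ ha, haI⟩, ha⟩
    obtain ⟨y, hy, hbad⟩ := exists_foldl_ruleStep hrules
    refine ⟨(l.map Atom.enc).map (encPred (· ∉ I)) ++ y, ?_, ?_⟩
    · have : d.length ≤ l.length := by
        rw [hd, List.length_reverse]
        exact List.length_filter_le _ _
      simp only [List.length_append, List.length_map, hy]
      gcongr
    · have hd' : (((l.map Atom.enc).filter (encPred (· ∉ I))).reverse ++ []) =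
          d.map Atom.enc := by
        rw [filter_encPred, ← List.map_reverse, hd, List.append_nil]
        congr!
      have hi' : (((l.map Atom.enc).filter (fun v => !encPred (· ∉ I) v)).reverse ++ []) =
          i.map Atom.enc := by
        rw [filter_not_encPred, ← List.map_reverse, hi, List.append_nil]
        simp
      simp only [Accepts, foldl_chooseList_map, hd', hi', hbad, true_iff]
      obtain ⟨a, ha, ha'⟩ := Set.exists_of_ssubset (hI.ssubset_of_ne hne)
      have := (hmd a).2 ⟨ha, ha'⟩
      intro hnil
      rw [List.map_eq_nil_iff.1 hnil] at this
      simp at this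

theorem encWith_mem_verifierLanguage {A : Language Bool} {P : S.Program} {l : List S.Atom}
    {y : List Bool} : encWords [P.encWith l, y] ∈ verifierLanguage A ↔
      Accepts A (P.rules.map Rule.enc) (l.map Atom.enc) y := by
  have h : ∀ a b : List Bool, splitItem (encWords [a, b]) = (a, encWords [b]) := fun a b => by
    rw [encWords_cons, splitItem_encItem_append]
  have h' : ∀ a : List Bool, splitItem (encWords [a]) = (a, []) := fun a => by
    rw [encWords_cons, splitItem_encItem_append, encWords_nil]
  change Accepts _ _ _ _ ↔ _
  simp only [h, h', Program.encWith, encAtoms, decWords_encWords]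

end AspSignature

/-- The answer set checking problem of `C`-decidable programs is in `co-NP^C`. -/
theorem mainTheorem8 (S : AspSignature) (C : Set (Language Bool)) (𝒜 : Set S.AggAtom)
    (h𝒜 : AspSignature.CDecidable C 𝒜) :
    ∃ L ∈ CoNPClass C, AspSignature.SolvesACP 𝒜 L := by
  obtain ⟨A, hAC, hA⟩ := h𝒜
  let q : Polynomial ℕ := Polynomial.X + Polynomial.X * Polynomial.X
  let N : Language Bool := {w | ∃ y : List Bool, y.length ≤ q.eval w.length ∧
    encWords [w, y] ∈ StackProg.verifierLanguage A}
  refine ⟨{w | w ∉ N}, ⟨N, ⟨A, hAC, StackProg.verifierLanguage A,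
    StackProg.verifierLanguage_mem_PRel A, q, fun w => Iff.rfl⟩, fun w => Iff.rfl⟩, ?_⟩
  intro P hP l M hl
  change ¬ (∃ y : List Bool, y.length ≤ q.eval (P.encWith l).length ∧
    encWords [P.encWith l, y] ∈ StackProg.verifierLanguage A) ↔ _
  rw [not_iff_comm]
  simp only [AspSignature.encWith_mem_verifierLanguage]
  constructor
  · intro h
    obtain ⟨y, hy, hacc⟩ := AspSignature.exists_accepts hA hP hl h
    refine ⟨y, hy.trans ?_, hacc⟩
    have hlen : P.rules.length ≤ (P.encWith l).length ∧ l.length ≤ (P.encWith l).length := by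
      have h1 := length_le_length_encWords (P.rules.map AspSignature.Rule.enc)
      have h2 := length_le_length_encWords (l.map AspSignature.Atom.enc)
      simp only [List.length_map] at h1 h2
      simp only [AspSignature.Program.encWith, AspSignature.encAtoms, encWords_cons,
        List.length_append, length_encItem]
      omega
    simp only [q, Polynomial.eval_add, Polynomial.eval_mul, Polynomial.eval_X]
    exact add_le_add hlen.2 (Nat.mul_le_mul hlen.1 hlen.2)
  · rintro ⟨y, -, hacc⟩
    exact AspSignature.not_isFixpointAnswerSet_of_accepts hA hP hl hacc
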